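/- Let $F$ be a field of characteristic zero with algebraic closure $\bar F$ and $\Gamma_F=\mathrm{Gal}(\bar F/F)$. Let $(\mathfrak g,K)$ be a Harish-Chandra pair over $F$: $K$ is an affine algebraic group over $F$ (for instance a reductive one), $\mathfrak g$ is a finite-dimensional Lie algebra on which $K$ acts by Lie algebra automorphisms, and there is given a $K$-equivariant Lie algebra homomorphism $\psi:\mathrm{Lie}(K)\to\mathfrak g$ such that the differential of the action of $K$ on $\mathfrak g$ is $\mathrm{ad}\circ\psi$. For an extension $k/F$, a $(k\otimes_F\mathfrak g,k\otimes_F K)$-module is a $k$-vector space with a representation of $k\otimes_FK$ and an action of the Lie algebra $k\otimes_F\mathfrak g$ such that the action map $\mathfrak g\otimes M\to M$ is $K$-equivariant and the differential of the $K$-action is the action of $\mathrm{Lie}(K)$ through $\psi$. Let $M$ be a $(\bar F\otimes_F\mathfrak g,\bar F\otimes_FK)$-module (resp. a representation of $\bar F\otimes_FK$) and put $\Gamma_M=\{\sigma\in\Gamma_F:{}^\sigma M\cong M\}$, where ${}^\sigma M=\bar F\otimes_{\sigma,\bar F}M$, and $F(M)=\bar F^{\Gamma_M}$. $M$ is self-conjugate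 if $\Gamma_M=\Gamma_F$. A class in the continuous cohomology group $H^2(\Gamma_M,\bar F^\times)$ is called a Borel--Tits class of $M$ if $\mathrm{End}(M)=\bar F\,\mathrm{id}_M$ and the class arises as follows: choose a finite Galois extension $E/F$ in $\bar F$, an $E$-form $M_E$ of $M$, and an isomorphism $\varphi_\sigma:{}^\sigma M_E\cong M_E$ for each $\sigma\in\mathrm{Gal}(E/F)$ that is the restriction of an element of $\Gamma_M$ (that is, $\sigma\in\mathrm{Gal}(E/F(M))$ when $\Gamma_M$ is closed); write $\varphi_\sigma\circ{}^\sigma\varphi_\tau=b(\sigma,\tau)\,\varphi_{\sigma\tau}$ (identifying ${}^\sigma({}^\tau M_E)={}^{\sigma\tau}M_E$) with a 2-cocycle $b$ with values in $E^\times$; and inflate the class of $b$ to $H^2(\Gamma_M,\bar F^\times)$. If there is exactly one Borel--Tits class, it is denoted $\beta^{\mathrm{BT}}_M$. Let $V$ be an irreducible $(\bar F\otimes_F\mathfrak g,\bar F\otimes_FK)$-module, and let $\tau$ be a self-conjugate irreducible finite-dimensional representation of $\bar F\otimes_FK$ that occurs in $V$ with multiplicity one, i.e. $\dim_{\bar F}\mathrm{Hom}_{\bar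 F\otimes_F K}(\tau,V)=1$. Then $V$ and $\tau$ each have exactly one Borel--Tits class, and $$\beta^{\mathrm{BT}}_V=\beta^{\mathrm{BT}}_\tau|_{\Gamma_V}\quad\text{in } H^2(\Gamma_V,\bar F^\times),$$ where $\beta^{\mathrm{BT}}_\tau|_{\Gamma_V}$ is the restriction of $\beta^{\mathrm{BT}}_\tau\in H^2(\Gamma_F,\bar F^\times)$. In particular $\beta^{\mathrm{BT}}_V=\beta^{\mathrm{BT}}_\tau$ in $H^2(\Gamma_F,\bar F^\times)$ if $V$ is self-conjugate. -/

import Mathlib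

open scoped TensorProduct

universe u v w

/-! ### Continuous second cohomology -/

section Cohomology

variable (Γ : Type*) [Group Γ] [TopologicalSpace Γ]
variable (M : Type*) [CommGroup M] [MulDistribMulAction Γ M]

/-- Continuous 2-cocycles of `Γ` with values in the discrete (multiplicative) `Γ`-module `M`:
locally constant `f : Γ × Γ → M` with `f (g h, j) f (g, h) = g • f (h, j) f (g, h j)`. -/
def contCocycles2 : Subgroup (Γ × Γ → M) where
  carrier := {f | IsLocallyConstant f ∧ groupCohomology.IsMulCocycle₂ f}
  one_mem' := ⟨IsLocallyConstant.const 1, fun g h j => by simp⟩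
  mul_mem' := by
    rintro f₁ f₂ ⟨hf₁, h₁⟩ ⟨hf₂, h₂⟩
    refine ⟨hf₁.mul hf₂, fun g h j => ?_⟩
    have e₁ := h₁ g h j
    have e₂ := h₂ g h j
    simp only [Pi.mul_apply, smul_mul']
    calc _ = (f₁ (g * h, j) * f₁ (g, h)) * (f₂ (g * h, j) * f₂ (g, h)) := by
          rw [mul_mul_mul_comm]
      _ = _ := by rw [e₁, e₂, mul_mul_mul_comm]
  inv_mem' := by
    rintro f ⟨hf, h⟩
    refine ⟨hf.inv, fun a b c => ?_⟩
    have e := h a b c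
    simp only [Pi.inv_apply, smul_inv']
    rw [← mul_inv, e, mul_inv]

/-- Continuous 2-coboundaries: `(g, h) ↦ g • x h / x (g h) * x g` for a locally constant `x`. -/
def contCoboundaries2 : Subgroup (Γ × Γ → M) where
  carrier := {f | ∃ x : Γ → M, IsLocallyConstant x ∧
    ∀ g h : Γ, g • x h / x (g * h) * x g = f (g, h)}
  one_mem' := ⟨1, IsLocallyConstant.const 1, fun g h => by simp⟩
  mul_mem' := by
    rintro f₁ f₂ ⟨x₁, hx₁, h₁⟩ ⟨x₂, hx₂, h₂⟩
    refine ⟨x₁ * x₂, hx₁.mul hx₂, fun g h => ?_⟩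
    simp only [Pi.mul_apply, smul_mul', ← h₁, ← h₂, div_eq_mul_inv, mul_inv]
    ac_rfl
  inv_mem' := by
    rintro f ⟨x, hx, h⟩
    refine ⟨x⁻¹, hx.inv, fun a b => ?_⟩
    simp only [Pi.inv_apply, smul_inv', ← h, div_eq_mul_inv, mul_inv]

/-- The continuous cohomology group `H²(Γ, M)`, `M` a discrete `Γ`-module, written
multiplicatively: continuous 2-cocycles modulo continuous 2-coboundaries. -/
abbrev ContH2 : Type _ :=
  contCocycles2 Γ M ⧸ (contCoboundaries2 Γ M).subgroupOf (contCocycles2 Γ M)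

variable {Γ M}
variable {Γ' : Type*} [Group Γ'] [TopologicalSpace Γ']
variable {M' : Type*} [CommGroup M'] [MulDistribMulAction Γ' M']

/-- Functoriality on cocycles, for a continuous homomorphism `φ : Γ' → Γ` and a homomorphism
`f : M → M'` compatible with `φ`. -/
def contCocycles2Map (φ : Γ' →* Γ) (hφ : Continuous φ) (f : M →* M')
    (hf : ∀ (g : Γ') (m : M), f (φ g • m) = g • f m) :
    contCocycles2 Γ M →* contCocycles2 Γ' M' where
  toFun z := ⟨fun p => f (z.1 (φ p.1, φ p.2)), by
    refine ⟨?_, fun g h j => ?_⟩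
    · have := (z.2.1.comp_continuous
        (f := fun p : Γ' × Γ' => (φ p.1, φ p.2)) (by fun_prop)).comp f
      exact this
    · have e := congrArg f (z.2.2 (φ g) (φ h) (φ j))
      simpa only [map_mul, hf] using e⟩
  map_one' := by ext p; simp
  map_mul' z₁ z₂ := by ext p; simp

/-- Functoriality of `H²`: restriction and inflation maps are special cases. -/
def ContH2.map (φ : Γ' →* Γ) (hφ : Continuous φ) (f : M →* M')
    (hf : ∀ (g : Γ') (m : M), f (φ g • m) = g • f m) :
    ContH2 Γ M →* ContH2 Γ' M' :=
  QuotientGroup.map _ _ (contCocycles2Map φ hφ f hf) (by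
    intro z hz
    obtain ⟨x, hx, h⟩ := Subgroup.mem_subgroupOf.1 hz
    refine Subgroup.mem_comap.2 (Subgroup.mem_subgroupOf.2
      ⟨fun g => f (x (φ g)), (hx.comp_continuous hφ).comp f, fun g k => ?_⟩)
    have e := congrArg f (h (φ g) (φ k))
    simp only [map_mul, map_div, hf] at e
    change g • f (x (φ k)) / f (x (φ (g * k))) * f (x (φ g)) = f (z.1 (φ g, φ k))
    rw [map_mul]
    exact e)

end Cohomology

/-! ### Algebraic groups and Harish-Chandra pairs

An affine algebraic group `K` over `F` is given by its coordinate ring `A = F[K]`, a commutative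
Hopf algebra of finite type. -/

section Pairs

variable (F : Type*) [Field F] (A : Type*) [CommRing A] [HopfAlgebra F A]

/-- The Lie algebra `Lie(K)`, as the space of point derivations of `F[K]` at the identity. -/
def lieOfGroup : Submodule F (Module.Dual F A) where
  carrier := {D | ∀ a b : A,
    D (a * b) = Coalgebra.counit (R := F) a * D b + Coalgebra.counit (R := F) b * D a}
  zero_mem' := by simp
  add_mem' := by
    intro D E hD hE a b
    simp only [LinearMap.add_apply, hD a b, hE a b]
    ring
  smul_mem' := by
    intro c D hD a b
    simp only [LinearMap.smul_apply, hD a b, smul_eq_mul]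
    ring

variable {F A}

/-- The convolution `D * E : a ↦ ∑ D(a₁) E(a₂)` on the dual of `F[K]`. -/
def dualConv (D E : Module.Dual F A) : Module.Dual F A :=
  LinearMap.mul' F F ∘ₗ TensorProduct.map D E ∘ₗ Coalgebra.comul

/-- The generic conjugate of `D`: the map `a ↦ ∑ a₁ D(a₂) S(a₃)` from `F[K]` to `F[K]`.
Composing with a point `p : F[K] → R` gives `Ad(p) D = p * D * p⁻¹`. -/
def dualAd (D : Module.Dual F A) : A →ₗ[F] A :=
  LinearMap.mul' F A ∘ₗ
    TensorProduct.map LinearMap.id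
      (LinearMap.mul' F A ∘ₗ
        TensorProduct.map (Algebra.linearMap F A ∘ₗ D) (HopfAlgebra.antipode F) ∘ₗ
          Coalgebra.comul) ∘ₗ
    Coalgebra.comul

/-- The pairing `(∑ Dᵢ ⊗ aᵢ, a) ↦ ∑ Dᵢ(a) aᵢ` of `Lie(K) ⊗ F[K]` with `F[K]`. -/
def lieContract (t : lieOfGroup F A ⊗[F] A) (a : A) : A :=
  TensorProduct.lid F A
    (TensorProduct.map (LinearMap.applyₗ a ∘ₗ (lieOfGroup F A).subtype) LinearMap.id t)

/-- For a linear map `ρ : V → V ⊗ F[K]`, the axioms of a right `F[K]`-comodule, that is, of a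
representation `g v = ∑ v₀ v₁(g)` of `K` on `V`. -/
structure IsCoaction {V : Type*} [AddCommGroup V] [Module F V] (ρ : V →ₗ[F] V ⊗[F] A) :
    Prop where
  counit : ∀ v, TensorProduct.rid F V ((Coalgebra.counit (R := F) (A := A)).lTensor V (ρ v)) = v
  coassoc : ∀ v, TensorProduct.assoc F V A A (ρ.rTensor A (ρ v)) =
    (Coalgebra.comul (R := F) (A := A)).lTensor V (ρ v)

variable (F A) in
/-- A (Harish-Chandra) pair `(𝔤, K)` over `F`: an action of `K` on the Lie algebra `𝔤` by Lie
algebra automorphisms and a `K`-equivariant homomorphism of Lie algebras `ψ : Lie(K) → 𝔤`,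
such that the differential of the action of `K` on `𝔤` is the adjoint action through `ψ`. -/
structure HCPair (g : Type*) [LieRing g] [LieAlgebra F g] where
  /-- the coaction of `F[K]` on `𝔤` -/
  Ad : g →ₗ[F] g ⊗[F] A
  /-- the map `Lie(K) → 𝔤` -/
  ψ : lieOfGroup F A →ₗ[F] g
  isCoaction : IsCoaction Ad
  /-- `K` acts by automorphisms of Lie algebras; the bracket of `𝔤 ⊗ F[K]` is `F[K]`-bilinear -/
  Ad_lie : ∀ x y : g, Ad ⁅x, y⁆ =
    TensorProduct.map₂ (LieModule.toEnd F g g : g →ₗ[F] Module.End F g) (LinearMap.mul F A)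
      (Ad x) (Ad y)
  /-- `ψ` is a homomorphism of Lie algebras; the bracket of `Lie(K)` is the convolution
  commutator -/
  ψ_lie : ∀ D E : lieOfGroup F A, ∃ B : lieOfGroup F A,
    (B : Module.Dual F A) = dualConv (D : Module.Dual F A) E - dualConv (E : Module.Dual F A) D ∧
      ψ B = ⁅ψ D, ψ E⁆
  /-- `ψ` is `K`-equivariant; here `t` is the image of `D` under the adjoint coaction
  `Lie(K) → Lie(K) ⊗ F[K]` -/
  ψ_equivariant : ∀ D : lieOfGroup F A, ∃ t : lieOfGroup F A ⊗[F] A,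
    (∀ a, lieContract t a = dualAd (D : Module.Dual F A) a) ∧ Ad (ψ D) = ψ.rTensor A t
  /-- the differential of the action of `K` on `𝔤` is `ad ∘ ψ` -/
  differential : ∀ (D : lieOfGroup F A) (x : g),
    TensorProduct.rid F g ((D : Module.Dual F A).lTensor g (Ad x)) = ⁅ψ D, x⁆

end Pairs

/-! ### Modules over an extension of the base field

For an extension `k/F`, a representation of `k ⊗ K` on a `k`-vector space `V` is a `k`-linear
coaction `V → V ⊗_k (k ⊗_F F[K]) = V ⊗_F F[K]`, and a `k`-linear action of `k ⊗ 𝔤` on `V` is an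
`F`-linear map from `𝔤` to the `k`-linear endomorphisms of `V`. -/

/-- The operators of `K` and of `L` on a `k`-vector space, without axioms. We take `L = 𝔤` for
`(k ⊗ 𝔤, k ⊗ K)`-modules, and the zero space `L = PUnit` for representations of `k ⊗ K`. -/
structure EquivData (F A L k V : Type*) [Field F] [CommRing A] [HopfAlgebra F A]
    [AddCommGroup L] [Module F L] [Field k] [Algebra F k]
    [AddCommGroup V] [Module F V] [Module k V] [IsScalarTower F k V] where
  /-- the coaction -/
  coact : V →ₗ[k] V ⊗[F] A
  /-- the action of `L` -/
  act : L →ₗ[F] Module.End k V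

namespace EquivData

section Basic

variable {F A L L' k V V' : Type*} [Field F] [CommRing A] [HopfAlgebra F A]
  [AddCommGroup L] [Module F L] [AddCommGroup L'] [Module F L'] [Field k] [Algebra F k]
  [AddCommGroup V] [Module F V] [Module k V] [IsScalarTower F k V]
  [AddCommGroup V'] [Module F V'] [Module k V'] [IsScalarTower F k V']

/-- The coaction as an `F`-linear map. -/
def coactF (d : EquivData F A L k V) : V →ₗ[F] V ⊗[F] A where
  toFun := d.coact
  map_add' := map_add d.coact
  map_smul' c v := by
    have h : c • v = (algebraMap F k c) • v := (algebraMap_smul k c v).symm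
    rw [h, map_smul, RingHom.id_apply, algebraMap_smul]

/-- The action of `L` as an `F`-bilinear map. -/
def actF (d : EquivData F A L k V) : L →ₗ[F] V →ₗ[F] V :=
  LinearMap.restrictScalarsₗ F k V V F ∘ₗ d.act

/-- A `k`-subspace stable under `K` and `L`. -/
def IsStable (d : EquivData F A L k V) (W : Submodule k V) : Prop :=
  (∀ v ∈ W, d.coact v ∈ LinearMap.range ((W.restrictScalars F).subtype.rTensor A)) ∧
  (∀ x : L, ∀ v ∈ W, d.act x v ∈ W)

/-- Irreducibility: nonzero, with no stable subspaces other than `0` and `V`. -/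
def IsIrreducible (d : EquivData F A L k V) : Prop :=
  Nontrivial V ∧ ∀ W : Submodule k V, d.IsStable W → W = ⊥ ∨ W = ⊤

/-- The space `Hom_{k ⊗ K}(V, V')` of homomorphisms of representations of `k ⊗ K`. -/
def homK (d : EquivData F A L k V) (d' : EquivData F A L' k V') : Submodule k (V →ₗ[k] V') where
  carrier := {f | ∀ v, d'.coact (f v) = (f.restrictScalars F).rTensor A (d.coact v)}
  zero_mem' v := by simp [LinearMap.restrictScalars_zero]
  add_mem' := by
    intro f f' hf hf' v
    simp [hf v, hf' v, LinearMap.restrictScalars_add, LinearMap.rTensor_add]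
  smul_mem' := by
    intro c f hf v
    rw [LinearMap.smul_apply, map_smul, hf v]
    induction d.coact v with
    | zero => simp
    | add s t hs ht => simp only [map_add, smul_add, hs, ht]
    | tmul s a => simp [TensorProduct.smul_tmul']

/-- All endomorphisms are scalars: `End(V) = k id`. -/
def HasScalarEnd (d : EquivData F A L k V) : Prop :=
  ∀ f : V →ₗ[k] V, f ∈ d.homK d → (∀ x v, f (d.act x v) = d.act x (f v)) →
    ∃ c : k, ∀ v, f v = c • v

/-- For `σ ∈ Gal(k/F)`, an isomorphism from the twist `σV = k ⊗_{σ,k} V` to `V`, written as a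
`σ`-semilinear automorphism `s` of `V` commuting with the operators of `K` and of `L`
(the isomorphism is `c ⊗ v ↦ c s(v)`). -/
structure IsTwistIso (d : EquivData F A L k V) (σ : Gal(k/F)) (s : V ≃ₗ[F] V) : Prop where
  semilinear : ∀ (c : k) (v : V), s (c • v) = σ c • s v
  coact : ∀ v, d.coact (s v) = s.toLinearMap.rTensor A (d.coact v)
  act : ∀ x v, s (d.act x v) = d.act x (s v)

/-- The group `Γ_V` of all `σ ∈ Gal(k/F)` with `σV ≅ V`. -/
def rationalityGroup (d : EquivData F A L k V) : Subgroup Gal(k/F) where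
  carrier := {σ | ∃ s, d.IsTwistIso σ s}
  one_mem' := ⟨LinearEquiv.refl F V, fun _ _ => rfl, fun v => by simp, fun _ _ => rfl⟩
  mul_mem' := by
    rintro σ τ ⟨s, hs⟩ ⟨t, ht⟩
    refine ⟨t.trans s, fun c v => ?_, fun v => ?_, fun x v => ?_⟩
    · simp [ht.semilinear, hs.semilinear]
    · rw [LinearEquiv.trans_apply, hs.coact, ht.coact, ← LinearMap.comp_apply,
        ← LinearMap.rTensor_comp]
      rfl
    · simp [ht.act, hs.act]
  inv_mem' := by
    rintro σ ⟨s, hs⟩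
    refine ⟨s.symm, fun c v => ?_, fun v => ?_, fun x v => ?_⟩
    · rw [LinearEquiv.symm_apply_eq, hs.semilinear]
      simp only [LinearEquiv.apply_symm_apply]
      congr 1
      exact (σ.apply_symm_apply c).symm
    · have h := hs.coact (s.symm v)
      rw [LinearEquiv.apply_symm_apply] at h
      rw [h, ← LinearMap.comp_apply, ← LinearMap.rTensor_comp]
      simp
    · rw [LinearEquiv.symm_apply_eq, hs.act, LinearEquiv.apply_symm_apply]

/-- `V` is self-conjugate: `σV ≅ V` for all `σ ∈ Gal(k/F)`. -/
def IsSelfConjugate (d : EquivData F A L k V) : Prop :=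
  ∀ σ : Gal(k/F), ∃ s, d.IsTwistIso σ s

/-- The data of a representation of `k ⊗ K`. -/
def IsKRep (d : EquivData F A PUnit.{1} k V) : Prop :=
  IsCoaction d.coactF

/-- The data of a `(k ⊗ 𝔤, k ⊗ K)`-module: a representation of `K`, a representation of `𝔤`, the
action map `𝔤 ⊗ V → V` is `K`-equivariant, and the differential of the action of `K` is the action
of `𝔤` through `ψ`. -/
structure IsGKModule {g : Type*} [LieRing g] [LieAlgebra F g] (P : HCPair F A g)
    (d : EquivData F A g k V) : Prop where
  isCoaction : IsCoaction d.coactF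
  lie : ∀ x y v, d.act ⁅x, y⁆ v = d.act x (d.act y v) - d.act y (d.act x v)
  equivariant : ∀ x v, d.coact (d.act x v) =
    TensorProduct.map₂ d.actF (LinearMap.mul F A) (P.Ad x) (d.coact v)
  differential : ∀ (D : lieOfGroup F A) (v : V),
    TensorProduct.rid F V ((D : Module.Dual F A).lTensor V (d.coact v)) = d.act (P.ψ D) v

end Basic

/-! ### Borel–Tits classes -/

section BorelTits

variable {F A L : Type*} [Field F] [CommRing A] [HopfAlgebra F A] [AddCommGroup L] [Module F L]

/-- Let `E/F` be finite Galois, `M` an object over `E` and `Δ` a group of `σ ∈ Gal(E/F)` with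
`σM ≅ M`. The class `c ∈ H²(Δ, Eˣ)` is represented by the cocycle `b` determined by a choice of
isomorphisms `φ_σ : σM ≅ M` through `φ_σ ∘ σ(φ_τ) = b(σ,τ) φ_{στ}`; in terms of the semilinear
automorphisms `s_σ` belonging to `φ_σ`, this reads `s_σ ∘ s_τ = b(σ,τ) s_{στ}`.

When `End(M) = E`, the `s_σ` form an `E`-basis of the algebra of those endomorphisms of `M` that are
linear over the fixed field of `Δ` only, i.e. of the endomorphism algebra of the restriction of
scalars of `M`. This is the crossed product of `E` and `Δ` by `b`, so that `c` is its class for the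
crossed product correspondence of central simple algebras and second cohomology. -/
def IsFiniteBorelTitsClass {E M : Type*} [Field E] [Algebra F E]
    [AddCommGroup M] [Module F M] [Module E M] [IsScalarTower F E M]
    (d : EquivData F A L E M) (Δ : Subgroup Gal(E/F)) (c : ContH2 Δ Eˣ) : Prop :=
  ∃ s : Δ → (M ≃ₗ[F] M), (∀ σ : Δ, d.IsTwistIso σ (s σ)) ∧
    ∃ b : contCocycles2 Δ Eˣ, (QuotientGroup.mk b : ContH2 Δ Eˣ) = c ∧
      ∀ (σ τ : Δ) (m : M), s σ (s τ m) = (b.1 (σ, τ) : E) • s (σ * τ) m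

variable {Fbar : Type*} [Field Fbar] [Algebra F Fbar]

/-- The image in `Gal(E/F)` of a subgroup `Γ` of `Gal(F̄/F)`. For `Γ = Gal(F̄/F₁)` with `F₁ ⊆ E`,
this is `Gal(E/F₁)`. -/
noncomputable def restrictGal (E : IntermediateField F Fbar) [Normal F E] (Γ : Subgroup Gal(Fbar/F)) :
    Subgroup Gal(E/F) :=
  Γ.map (AlgEquiv.restrictNormalHom E)

/-- The inflation map `H²(Γ|_E, Eˣ) → H²(Γ, F̄ˣ)`. -/
noncomputable def inflation (E : IntermediateField F Fbar) [Normal F E]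
    (Γ : Subgroup Gal(Fbar/F)) :
    ContH2 (restrictGal E Γ) Eˣ →* ContH2 Γ Fbarˣ :=
  ContH2.map
    ((AlgEquiv.restrictNormalHom E).subgroupMap Γ)
    (Continuous.subtype_mk
      ((InfiniteGalois.restrictNormalHom_continuous E).comp continuous_subtype_val) _)
    (Units.map (algebraMap E Fbar))
    (by
      intro γ m
      ext
      exact AlgEquiv.restrictNormal_commutes γ.1 E (m : E))

/-- The restriction map `H²(Γ, F̄ˣ) → H²(Γ', F̄ˣ)` for `Γ' ≤ Γ`. -/
noncomputable def restriction {Γ' Γ : Subgroup Gal(Fbar/F)} (h : Γ' ≤ Γ) :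
    ContH2 Γ Fbarˣ →* ContH2 Γ' Fbarˣ :=
  ContH2.map (Subgroup.inclusion h)
    (Continuous.subtype_mk continuous_subtype_val _) (MonoidHom.id _) (fun _ _ => rfl)

/-- An `E`-form of `V` with `E ⊆ F̄`: an object `M` over `E` together with an isomorphism
`F̄ ⊗_E M ≅ V`, written as an `E`-linear map `M → V` commuting with the operators of `K` and `L`
that exhibits `V` as the base change of `M`. The predicate `C` says which data are the objects
of the category under consideration. -/
structure Form {V : Type w} [AddCommGroup V] [Module F V] [Module Fbar V]
    [IsScalarTower F Fbar V] (d : EquivData F A L Fbar V) (E : IntermediateField F Fbar)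
    (C : ∀ (M : Type w) [AddCommGroup M] [Module F M] [Module E M] [IsScalarTower F E M],
      EquivData F A L E M → Prop) where
  /-- the `E`-vector space -/
  M : Type w
  [addCommGroup : AddCommGroup M]
  [moduleF : Module F M]
  [moduleE : Module E M]
  [isScalarTower : IsScalarTower F E M]
  /-- the operators on `M` -/
  data : EquivData F A L E M
  isObject : C M data
  /-- the map `m ↦ 1 ⊗ m` -/
  ι : M →ₗ[F] V
  map_smul : ∀ (c : E) (m : M), ι (c • m) = (c : Fbar) • ι m
  /-- the induced map `F̄ ⊗_E M → V` is bijective -/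
  isBaseChange : IsBaseChange Fbar
    ({ toFun := ι, map_add' := map_add ι, map_smul' := map_smul } : M →ₗ[E] V)
  coact : ∀ m, d.coact (ι m) = ι.rTensor A (data.coact m)
  act : ∀ x m, d.act x (ι m) = ι (data.act x m)

attribute [instance] Form.addCommGroup Form.moduleF Form.moduleE Form.isScalarTower

/-- The class `c ∈ H²(Γ_V, F̄ˣ)` arises by the Borel–Tits construction: `End(V) = F̄`, and for some
form `M` of `V` over a finite Galois extension `E/F` in `F̄`, `c` is the inflation of the
class of `M` in `H²(Gal(E/F(V)), Eˣ)`, where `F(V)` is the fixed field of `Γ_V`. -/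
def IsBorelTitsClass {V : Type w} [AddCommGroup V] [Module F V] [Module Fbar V]
    [IsScalarTower F Fbar V] (d : EquivData F A L Fbar V)
    (C : ∀ (E : IntermediateField F Fbar) (M : Type w) [AddCommGroup M] [Module F M] [Module E M]
      [IsScalarTower F E M], EquivData F A L E M → Prop)
    (c : ContH2 d.rationalityGroup Fbarˣ) : Prop :=
  d.HasScalarEnd ∧
  ∃ (E : IntermediateField F Fbar) (_ : FiniteDimensional F E) (_ : IsGalois F E)
    (X : Form d E (C E)) (c' : ContH2 (restrictGal E d.rationalityGroup) Eˣ),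
    IsFiniteBorelTitsClass X.data (restrictGal E d.rationalityGroup) c' ∧
      c = inflation E d.rationalityGroup c'

/-- `c` is the Borel–Tits class of the representation of `F̄ ⊗ K` given by `d`. -/
def IsBorelTitsClassK {V : Type w} [AddCommGroup V] [Module F V] [Module Fbar V]
    [IsScalarTower F Fbar V] (d : EquivData F A PUnit.{1} Fbar V)
    (c : ContH2 d.rationalityGroup Fbarˣ) : Prop :=
  d.IsBorelTitsClass (fun _ _ _ _ _ _ d' => d'.IsKRep) c

/-- `c` is the Borel–Tits class of the `(F̄ ⊗ 𝔤, F̄ ⊗ K)`-module given by `d`. -/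
def IsBorelTitsClassGK {g : Type*} [LieRing g] [LieAlgebra F g] (P : HCPair F A g)
    {V : Type w} [AddCommGroup V] [Module F V] [Module Fbar V]
    [IsScalarTower F Fbar V] (d : EquivData F A g Fbar V)
    (c : ContH2 d.rationalityGroup Fbarˣ) : Prop :=
  d.IsBorelTitsClass (fun _ _ _ _ _ _ d' => d'.IsGKModule P) c

theorem IsSelfConjugate.le {L : Type*} [AddCommGroup L] [Module F L]
    {V : Type*} [AddCommGroup V] [Module F V] [Module Fbar V]
    [IsScalarTower F Fbar V] {d : EquivData F A L Fbar V} (h : d.IsSelfConjugate)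
    (Γ : Subgroup Gal(Fbar/F)) : Γ ≤ d.rationalityGroup :=
  fun σ _ => h σ

end BorelTits

end EquivData

/-! ### Locally constant Galois actions -/

/-! Let `φ : τ → V` be a nonzero `K`-map, unique up to scalars by multiplicity one. If `S γ` and `T
γ` are `γ`-semilinear automorphisms of `V` and `τ` commuting with the operators, then `S γ ∘ φ ∘ (T
γ)⁻¹` is again a `K`-map, so `S γ ∘ φ = y γ • φ ∘ T γ` for a scalar `y γ`. Evaluating `S γ ∘ S δ ∘
φ` in two ways shows that the cocycles of `S` and `T` differ by the coboundary of `y`, which is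
locally constant as soon as `S` and `T` are locally constant on vectors (`IsTwistSystem.class_eq`,
`IsTwistSystem.class_eq_of_finrank_homK`).

To reach this situation, the Borel–Tits data of an `E`-form are extended semilinearly to the object
over `F̄`; the cocycle of the extended system represents the inflated class
(`Form.exists_isTwistSystem`). Systems from two different forms live on the same object and differ
by scalars, since all endomorphisms are scalars. The same computation with `φ = id` then gives
uniqueness of the class.

Existence needs three things. (1) Scalar endomorphisms: for `τ` by an eigenvalue; for `V`, possibly
infinite-dimensional, because `f ∘ φ = c • φ` makes the image of `φ` consist of eigenvectors. (2)
Twist isomorphisms descend to a form after rescaling (`Form.exists_isTwistIso`): compose with a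
projection of `V` to the form induced by an `E`-linear functional on `F̄`. (3) A form over a finite
Galois extension. For `τ` a finite set of scalars suffices to write the coaction in a basis. The
module `V` is generated over `𝔤` by the image of `φ`; its relations are controlled by finitely many
of them. This is the Gröbner-basis argument for Noetherianity: order the monomials `x^α w_j` by
degree, then lexicographically. A relation expressing one monomial through smaller ones can be
multiplied by a basis element of `𝔤`, the commutators entering only in lower degree and with
coefficients in `F`. By Dickson's lemma finitely many relations yield all the leading indices. Over
a field `E` containing their coefficients the remaining, standard monomials span the same `E`-space
as all words, and they are an `F̄`-basis of `V`. -/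

theorem isLocallyConstant_galois_apply {F K : Type*} [Field F] [Field K] [Algebra F K]
    [Algebra.IsIntegral F K] (c : K) : IsLocallyConstant fun σ : Gal(K/F) => σ c := by
  rw [IsLocallyConstant.iff_exists_open]
  intro σ
  -- The neighbourhood of `σ` is the coset `σ Stab(c)`, open because `c` is algebraic.
  refine ⟨(σ⁻¹ * ·) ⁻¹' (MulAction.stabilizer Gal(K/F) c : Set Gal(K/F)),
    (stabilizer_isOpen_of_isIntegral c).preimage (continuous_const_mul _), ?_, ?_⟩
  · simp
  · intro τ hτ
    have h : (σ⁻¹ * τ) c = c := hτ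
    rw [AlgEquiv.mul_apply] at h
    have h' := congrArg σ h
    rwa [← AlgEquiv.mul_apply, mul_inv_cancel, AlgEquiv.one_apply] at h'

namespace EquivData

/-! ### Twist isomorphisms and semilinear maps on `V ⊗ F[K]` -/

section

variable {F A L L' k V V' : Type*} [Field F] [CommRing A] [HopfAlgebra F A]
  [AddCommGroup L] [Module F L] [AddCommGroup L'] [Module F L'] [Field k] [Algebra F k]
  [AddCommGroup V] [Module F V] [Module k V] [IsScalarTower F k V]
  [AddCommGroup V'] [Module F V'] [Module k V'] [IsScalarTower F k V']

theorem rTensor_semilinear (σ : k → k) (f : V →ₗ[F] V') (hf : ∀ (c : k) v, f (c • v) = σ c • f v)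
    (c : k) (t : V ⊗[F] A) : f.rTensor A (c • t) = σ c • f.rTensor A t := by
  induction t with
  | zero => simp
  | add s t hs ht => simp only [map_add, smul_add, hs, ht]
  | tmul s a => simp [TensorProduct.smul_tmul', hf]

omit [Module k V] [IsScalarTower F k V] in
theorem rTensor_smul_apply (a : k) (f g : V →ₗ[F] V') (h : ∀ v, f v = a • g v) (t : V ⊗[F] A) :
    f.rTensor A t = a • g.rTensor A t := by
  induction t with
  | zero => simp
  | add s t hs ht => simp only [map_add, smul_add, hs, ht]
  | tmul s a => simp [TensorProduct.smul_tmul', h]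

/-- The composite of twist isomorphisms. -/
theorem IsTwistIso.comp {d : EquivData F A L k V} {σ τ : Gal(k/F)} {s t : V ≃ₗ[F] V}
    (hs : d.IsTwistIso σ s) (ht : d.IsTwistIso τ t) : d.IsTwistIso (σ * τ) (t.trans s) := by
  refine ⟨fun c v => ?_, fun v => ?_, fun x v => ?_⟩
  · simp [ht.semilinear, hs.semilinear]
  · rw [LinearEquiv.trans_apply, hs.coact, ht.coact, ← LinearMap.comp_apply,
      ← LinearMap.rTensor_comp]
    rfl
  · simp [ht.act, hs.act]

/-- The inverse of a twist isomorphism. -/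
theorem IsTwistIso.symm {d : EquivData F A L k V} {σ : Gal(k/F)} {s : V ≃ₗ[F] V}
    (hs : d.IsTwistIso σ s) : d.IsTwistIso σ⁻¹ s.symm := by
  refine ⟨fun c v => ?_, fun v => ?_, fun x v => ?_⟩
  · rw [LinearEquiv.symm_apply_eq, hs.semilinear]
    simp only [LinearEquiv.apply_symm_apply]
    congr 1
    exact (σ.apply_symm_apply c).symm
  · have h := hs.coact (s.symm v)
    rw [LinearEquiv.apply_symm_apply] at h
    rw [h, ← LinearMap.comp_apply, ← LinearMap.rTensor_comp]
    simp
  · rw [LinearEquiv.symm_apply_eq, hs.act, LinearEquiv.apply_symm_apply]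

end

/-! ### Twist systems over `F̄` and comparison of their classes -/

section Systems

variable {F A L L' : Type*} [Field F] [CommRing A] [HopfAlgebra F A] [AddCommGroup L] [Module F L]
  [AddCommGroup L'] [Module F L']
variable {Fbar : Type*} [Field Fbar] [Algebra F Fbar]
variable {V V' : Type*} [AddCommGroup V] [Module F V] [Module Fbar V] [IsScalarTower F Fbar V]
  [AddCommGroup V'] [Module F V'] [Module Fbar V'] [IsScalarTower F Fbar V']

/-- A locally constant family of twist isomorphisms of `V`, indexed by a group `Γ` of
automorphisms of `F̄`, that is multiplicative up to the 2-cocycle `b`. -/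
structure IsTwistSystem (d : EquivData F A L Fbar V) {Γ : Subgroup Gal(Fbar/F)}
    (S : Γ → (V ≃ₗ[F] V)) (b : contCocycles2 Γ Fbarˣ) : Prop where
  twist : ∀ γ : Γ, d.IsTwistIso γ (S γ)
  locConst : ∀ v, IsLocallyConstant fun γ => S γ v
  mul : ∀ (γ δ : Γ) v, S γ (S δ v) = (b.1 (γ, δ) : Fbar) • S (γ * δ) v

theorem IsTwistSystem.restrict {d : EquivData F A L Fbar V} {Γ Γ' : Subgroup Gal(Fbar/F)}
    {S : Γ → (V ≃ₗ[F] V)} {b : contCocycles2 Γ Fbarˣ} (h : d.IsTwistSystem S b) (hΓ : Γ' ≤ Γ) :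
    ∃ b' : contCocycles2 Γ' Fbarˣ, d.IsTwistSystem (fun γ => S (Subgroup.inclusion hΓ γ)) b' ∧
      (QuotientGroup.mk b' : ContH2 Γ' Fbarˣ) = restriction hΓ (QuotientGroup.mk b) := by
  have hc : Continuous (Subgroup.inclusion hΓ) := Continuous.subtype_mk continuous_subtype_val _
  refine ⟨contCocycles2Map (Subgroup.inclusion hΓ) hc (MonoidHom.id _) (fun _ _ => rfl) b,
    ⟨fun γ => h.twist (Subgroup.inclusion hΓ γ), fun v => (h.locConst v).comp_continuous hc, fun γ δ v => ?_⟩, rfl⟩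
  rw [h.mul, map_mul]
  rfl

/-- Twist systems on two objects that agree up to scalars along a nonzero linear map have the
same class. -/
theorem IsTwistSystem.class_eq {d : EquivData F A L Fbar V} {d' : EquivData F A L' Fbar V'}
    {Γ : Subgroup Gal(Fbar/F)} {S : Γ → (V ≃ₗ[F] V)} {T : Γ → (V' ≃ₗ[F] V')}
    {b b' : contCocycles2 Γ Fbarˣ} (hS : d.IsTwistSystem S b) (hT : d'.IsTwistSystem T b')
    (φ : V' →ₗ[Fbar] V) (hφ : φ ≠ 0) (y : Γ → Fbarˣ)
    (hy : ∀ γ v, S γ (φ v) = (y γ : Fbar) • φ (T γ v)) :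
    (QuotientGroup.mk b : ContH2 Γ Fbarˣ) = QuotientGroup.mk b' := by
  obtain ⟨v, hv⟩ : ∃ v, φ v ≠ 0 := by
    by_contra! h
    exact hφ (LinearMap.ext h)
  have hne : ∀ γ w, φ w ≠ 0 → φ (T γ w) ≠ 0 := by
    intro γ w hw h
    have := hy γ w
    rw [h, smul_zero, LinearEquiv.map_eq_zero_iff] at this
    exact hw this
  -- Near `γ` neither `S γ (φ v)` nor `T γ v` changes, and `y γ` is their ratio along the nonzero
  -- vector `φ (T γ v)`.
  have hyl : IsLocallyConstant y := by
    rw [IsLocallyConstant.iff_eventually_eq]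
    intro γ
    filter_upwards [(hS.locConst (φ v)).eventually_eq γ, (hT.locConst v).eventually_eq γ]
      with δ h₁ h₂
    rw [hy, hy, h₂] at h₁
    exact Units.ext (smul_left_injective _ (hne γ v hv) h₁)
  symm
  rw [QuotientGroup.eq]
  refine Subgroup.mem_subgroupOf.2 ⟨y, hyl, fun γ δ => ?_⟩
  -- Both sides come from `S γ (S δ (φ v))`: move the product to `S (γ * δ)` first, or pass each
  -- factor through `φ` first.
  have key : ((b.1 (γ, δ) : Fbar) * y (γ * δ)) • φ (T (γ * δ) v) =
      ((γ • y δ : Fbarˣ) * y γ * b'.1 (γ, δ) : Fbar) • φ (T (γ * δ) v) := by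
    have e := hS.mul γ δ (φ v)
    rw [hy δ, (hS.twist γ).semilinear, hy γ, hT.mul, map_smul, hy (γ * δ), smul_smul, smul_smul,
      smul_smul] at e
    rw [← e]
    rfl
  have key' := smul_left_injective _ (hne (γ * δ) v hv) key
  have key2 : b.1 (γ, δ) * y (γ * δ) = γ • y δ * y γ * b'.1 (γ, δ) := Units.ext (by simpa using key')
  change _ = (b'.1 (γ, δ))⁻¹ * b.1 (γ, δ)
  rw [eq_inv_mul_iff_mul_eq, div_mul_eq_mul_div, ← mul_div_assoc, div_eq_iff_eq_mul, key2, mul_comm]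

end Systems

/-! ### Semilinear extension along a base change, and rescaling -/

section Extension

variable {F : Type*} [Field F] {Fbar : Type*} [Field Fbar] [Algebra F Fbar]
  {E : IntermediateField F Fbar}
  {V M : Type*} [AddCommGroup V] [Module F V] [Module Fbar V] [IsScalarTower F Fbar V]
  [AddCommGroup M] [Module F M] [Module E M]

/-- In the `F̄`-basis of `V` given by an `E`-basis of `M`, apply `γ` to the coordinates and replace
each basis vector by its prescribed image. -/
theorem exists_semilinear_extension {ι : M →ₗ[E] V} (hι : IsBaseChange Fbar ι) (γ : Gal(Fbar/F))
    (h : M →ₗ[F] V) (hh : ∀ (c : E) m, h (c • m) = γ c • h m) :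
    ∃ S : V →ₗ[F] V, (∀ (c : Fbar) v, S (c • v) = γ c • S v) ∧ ∀ m, S (ι m) = h m := by
  classical
  let B := Module.Basis.ofVectorSpace E M
  let b := hι.basis B
  let S : V →ₗ[F] V := (Finsupp.linearCombination Fbar (fun i => h (B i))).restrictScalars F ∘ₗ
    Finsupp.mapRange.linearMap γ.toLinearMap ∘ₗ (b.repr.toLinearMap.restrictScalars F)
  have hS : ∀ v, S v = Finsupp.linearCombination Fbar (fun i => h (B i))
    (Finsupp.mapRange γ (map_zero γ) (b.repr v)) := fun v => rfl
  have hsm : ∀ (c : Fbar) v, S (c • v) = γ c • S v := by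
    intro c v
    rw [hS, hS, ← map_smul]
    congr 1
    ext i
    simp
  refine ⟨S, hsm, fun m => ?_⟩
  have hm : m ∈ Submodule.span E (Set.range B) := by rw [B.span_eq]; trivial
  induction hm using Submodule.span_induction with
  | mem x hx =>
    obtain ⟨i, rfl⟩ := hx
    rw [← hι.basis_apply B i, hS]
    change Finsupp.linearCombination Fbar (fun i => h (B i))
      (Finsupp.mapRange γ (map_zero γ) (b.repr (b i))) = _
    simp
  | zero => simp
  | add x y _ _ hx hy => simp only [map_add, hx, hy]
  | smul c x _ hx =>
    rw [map_smul, hh, ← hx, ← hsm]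
    rfl

end Extension

theorem isScalarTower_intermediateField {F Fbar : Type*} [Field F] [Field Fbar] [Algebra F Fbar]
    (E : IntermediateField F Fbar) (V : Type*) [AddCommGroup V] [Module F V] [Module Fbar V]
    [IsScalarTower F Fbar V] : IsScalarTower F E V :=
  ⟨fun a e v => smul_assoc a (e : Fbar) v⟩

section Scale

variable {F A L k V : Type*} [Field F] [CommRing A] [HopfAlgebra F A]
  [AddCommGroup L] [Module F L] [Field k] [Algebra F k]
  [AddCommGroup V] [Module F V] [Module k V] [IsScalarTower F k V]

/-- Twist isomorphisms may be rescaled. -/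
theorem IsTwistIso.exists_smul {d : EquivData F A L k V} {σ : Gal(k/F)} {s : V ≃ₗ[F] V}
    (hs : d.IsTwistIso σ s) {c : k} (hc : c ≠ 0) :
    ∃ t : V ≃ₗ[F] V, d.IsTwistIso σ t ∧ ∀ v, t v = c • s v := by
  let t : V ≃ₗ[F] V := s.trans ((LinearEquiv.smulOfNeZero k V c hc).restrictScalars F)
  have ht : ∀ v, t v = c • s v := fun v => rfl
  refine ⟨t, ⟨fun a v => ?_, fun v => ?_, fun x v => ?_⟩, ht⟩
  · rw [ht, ht, hs.semilinear, smul_comm]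
  · rw [ht, map_smul, hs.coact]
    exact (rTensor_smul_apply c _ _ ht _).symm
  · rw [ht, ht, hs.act, map_smul]

end Scale

/-! ### Descent of equivariant maps between an object and its forms -/

namespace Form

variable {F A L : Type*} [Field F] [CommRing A] [HopfAlgebra F A] [AddCommGroup L] [Module F L]
variable {Fbar : Type*} [Field Fbar] [Algebra F Fbar]
variable {V : Type w} [AddCommGroup V] [Module F V] [Module Fbar V] [IsScalarTower F Fbar V]
  {d : EquivData F A L Fbar V} {E : IntermediateField F Fbar}
  {C : ∀ (M : Type w) [AddCommGroup M] [Module F M] [Module E M] [IsScalarTower F E M],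
    EquivData F A L E M → Prop}

/-- The map of a form into the object, as an `E`-linear map. -/
def ιE (X : Form d E C) : X.M →ₗ[E] V where
  toFun := X.ι
  map_add' := map_add X.ι
  map_smul' := X.map_smul

theorem isBaseChange_ιE (X : Form d E C) : IsBaseChange Fbar X.ιE := X.isBaseChange

theorem ιE_apply (X : Form d E C) (m : X.M) : X.ιE m = X.ι m := rfl

@[elab_as_elim]
theorem induction (X : Form d E C) {p : V → Prop} (v : V) (zero : p 0) (ι : ∀ m, p (X.ι m))
    (smul : ∀ (c : Fbar) v, p v → p (c • v)) (add : ∀ v w, p v → p w → p (v + w)) : p v :=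
  X.isBaseChange.inductionOn v p zero ι smul add

/-- The coordinates of an element of the form lie in `E`. -/
theorem exists_eq_of_smul_eq (X : Form d E C) {a : Fbar} {m m' : X.M} (hm : m ≠ 0)
    (h : a • X.ι m = X.ι m') : ∃ e : E, (e : Fbar) = a := by
  let B := Module.Basis.ofVectorSpace E X.M
  obtain ⟨i, hi⟩ : ∃ i, B.repr m i ≠ 0 := by
    by_contra! h0
    exact hm (B.repr.map_eq_zero_iff.1 (Finsupp.ext h0))
  -- Comparing the `i`-th coordinates exhibits `a` as a quotient of two elements of `E`.
  have e := congrArg (fun v => (X.isBaseChange_ιE.basis B).repr v i) h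
  simp only [← ιE_apply, _root_.map_smul, Finsupp.smul_apply, IsBaseChange.basis_repr_comp_apply,
    smul_eq_mul] at e
  refine ⟨B.repr m' i / B.repr m i, ?_⟩
  have hi' : algebraMap E Fbar (B.repr m i) ≠ 0 := by simpa using hi
  have e' : a = algebraMap E Fbar (B.repr m' i) / algebraMap E Fbar (B.repr m i) := by
    rw [eq_div_iff hi', e]
  rw [e', ← map_div₀]
  rfl

theorem ι_injective (X : Form d E C) : Function.Injective X.ι := by
  rw [injective_iff_map_eq_zero]
  intro m hm
  let B := Module.Basis.ofVectorSpace E X.M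
  refine B.repr.map_eq_zero_iff.1 (Finsupp.ext fun i => ?_)
  have e := X.isBaseChange_ιE.basis_repr_comp_apply B m i
  rw [ιE_apply, hm, map_zero] at e
  exact ((map_eq_zero (algebraMap E Fbar)).1 e.symm)

theorem rTensor_ι_injective (X : Form d E C) : Function.Injective (X.ι.rTensor A) :=
  Module.Flat.rTensor_preserves_injective_linearMap _ X.ι_injective

theorem exists_ne_zero [Nontrivial V] (X : Form d E C) : ∃ m : X.M, m ≠ 0 := by
  by_contra! h
  obtain ⟨v, hv⟩ := exists_ne (0 : V)
  refine hv (X.induction (p := fun v => v = 0) v rfl (fun m => by rw [h m, map_zero])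
    (fun c v hv => by rw [hv, smul_zero]) (fun v w hv hw => by rw [hv, hw, add_zero]))

/-- An equivariant `E`-linear map from a form to the object is a multiple of the inclusion. -/
theorem exists_eq_smul_ι (X : Form d E C) (hd : d.HasScalarEnd) (h : X.M →ₗ[F] V)
    (hsmul : ∀ (c : E) m, h (c • m) = (c : Fbar) • h m)
    (hcoact : ∀ m, d.coact (h m) = h.rTensor A (X.data.coact m))
    (hact : ∀ x m, d.act x (h m) = h (X.data.act x m)) :
    ∃ c : Fbar, ∀ m, h m = c • X.ι m := by
  let hE : X.M →ₗ[E] V := { toFun := h, map_add' := map_add h, map_smul' := hsmul }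
  let H : V →ₗ[Fbar] V := X.isBaseChange_ιE.lift hE
  have hH : ∀ m, H (X.ι m) = h m := fun m => X.isBaseChange_ιE.lift_eq hE m
  obtain ⟨c, hc⟩ := hd H (fun v => by
    refine X.induction v ?_ (fun m => ?_) (fun c v hv => ?_) (fun v w hv hw => ?_)
    · simp
    · rw [hH, hcoact, X.coact, ← LinearMap.comp_apply, ← LinearMap.rTensor_comp]
      congr 2
      ext m
      exact (hH m).symm
    · rw [_root_.map_smul, _root_.map_smul, hv, _root_.map_smul,
        rTensor_semilinear (A := A) id (H.restrictScalars F) (fun c v => _root_.map_smul H c v)]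
      rfl
    · simp only [map_add, hv, hw]) (fun x v => by
    refine X.induction v ?_ (fun m => ?_) (fun c v hv => ?_) (fun v w hv hw => ?_)
    · simp
    · rw [hH, hact, X.act, hH]
    · simp only [_root_.map_smul, hv]
    · simp only [map_add, hv, hw])
  exact ⟨c, fun m => by rw [← hH, hc]⟩

/-- The endomorphisms of a form of an object with scalar endomorphisms are scalars in `E`. -/
theorem exists_scalar_end (X : Form d E C) (hd : d.HasScalarEnd) [Nontrivial V] (f : X.M →ₗ[F] X.M)
    (hsmul : ∀ (c : E) m, f (c • m) = c • f m)
    (hcoact : ∀ m, X.data.coact (f m) = f.rTensor A (X.data.coact m))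
    (hact : ∀ x m, X.data.act x (f m) = f (X.data.act x m)) : ∃ c : E, ∀ m, f m = c • m := by
  obtain ⟨c, hc⟩ := X.exists_eq_smul_ι hd (X.ι ∘ₗ f)
    (fun c m => by simp [hsmul, X.map_smul])
    (fun m => by
      rw [LinearMap.comp_apply, X.coact, hcoact, LinearMap.rTensor_comp, LinearMap.comp_apply])
    (fun x m => by simp [X.act, hact])
  obtain ⟨m₀, hm₀⟩ := X.exists_ne_zero
  -- The scalar, found over `F̄`, carries the nonzero vector `ι m₀` to a vector of the form, hence
  -- lies in `E`.
  obtain ⟨e, rfl⟩ := X.exists_eq_of_smul_eq hm₀ (hc m₀).symm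
  exact ⟨e, fun m => X.ι_injective (by rw [X.map_smul, ← hc]; rfl)⟩

/-- The projection of the object to a form defined by an `E`-linear functional on `F̄`. -/
theorem exists_projection (X : Form d E C) {v₀ : V} (hv₀ : v₀ ≠ 0) :
    ∃ π : V →ₗ[F] X.M, (∀ (c : E) v, π ((c : Fbar) • v) = c • π v) ∧
      (∀ v, X.data.coact (π v) = π.rTensor A (d.coact v)) ∧
      (∀ x v, X.data.act x (π v) = π (d.act x v)) ∧ π v₀ ≠ 0 := by
  let B := Module.Basis.ofVectorSpace E X.M
  let b := X.isBaseChange_ιE.basis B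
  obtain ⟨i, hi⟩ : ∃ i, b.repr v₀ i ≠ 0 := by
    by_contra! h0
    exact hv₀ (b.repr.map_eq_zero_iff.1 (Finsupp.ext h0))
  obtain ⟨Λ, hΛ⟩ : ∃ Λ : Module.Dual E Fbar, Λ (b.repr v₀ i) ≠ 0 := by
    by_contra! h0
    exact hi ((Module.forall_dual_apply_eq_zero_iff E _).1 h0)
  -- This is `Λ ⊗ id` on `F̄ ⊗_E M`; the choice of `Λ` keeps the `i`-th coordinate of `v₀` alive.
  let πE : V →ₗ[E] X.M := B.repr.symm.toLinearMap ∘ₗ Finsupp.mapRange.linearMap Λ ∘ₗ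
    (b.repr.toLinearMap.restrictScalars E)
  have hπ : ∀ v i, B.repr (πE v) i = Λ (b.repr v i) := fun v i => by simp [πE]
  have hπι : ∀ (c : Fbar) m, πE (c • X.ι m) = Λ c • m := fun c m => by
    refine B.repr.injective (Finsupp.ext fun i => ?_)
    rw [hπ, _root_.map_smul, _root_.map_smul, Finsupp.smul_apply, Finsupp.smul_apply, ← ιE_apply,
      X.isBaseChange_ιE.basis_repr_comp_apply, smul_eq_mul, mul_comm, ← Algebra.smul_def, _root_.map_smul,
      smul_eq_mul, smul_eq_mul, mul_comm]
  have := isScalarTower_intermediateField E V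
  let π : V →ₗ[F] X.M := πE.restrictScalars F
  have hπι' : ∀ (c : Fbar) m, π (c • X.ι m) = Λ c • m := hπι
  -- The projection is not `F̄`-linear, so the induction has to run over the additive generators `c
  -- • ι m`.
  have hind : ∀ {p : V → Prop} (v : V), p 0 → (∀ (c : Fbar) m, p (c • X.ι m)) →
      (∀ v w, p v → p w → p (v + w)) → p v := by
    intro p v h0 h1 h2
    suffices h : ∀ c : Fbar, p (c • v) by simpa using h 1
    refine X.induction v (by simpa using h0) (fun m c => h1 c m)
      (fun a v hv c => by rw [smul_smul]; exact hv _)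
      (fun v w hv hw c => by rw [smul_add]; exact h2 _ _ (hv c) (hw c))
  refine ⟨π, fun c v => πE.map_smul c v, fun v => ?_, fun x v => ?_, fun h0 => ?_⟩
  · refine hind (p := fun v => X.data.coact (π v) = π.rTensor A (d.coact v)) v ?_ (fun c m => ?_) (fun v w hv hw => ?_)
    · simp
    rotate_left
    · simp only [map_add, hv, hw]
    have : ∀ t : X.M ⊗[F] A, π.rTensor A (c • X.ι.rTensor A t) = Λ c • t := by
      intro t
      induction t with
      | zero => simp
      | add s t hs ht => simp only [map_add, smul_add, hs, ht]
      | tmul s a =>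
        rw [LinearMap.rTensor_tmul, TensorProduct.smul_tmul', LinearMap.rTensor_tmul,
          TensorProduct.smul_tmul']
        congr 1
        exact hπι c s
    rw [hπι', d.coact.map_smul, X.coact, this, _root_.map_smul]
  · refine hind (p := fun v => X.data.act x (π v) = π (d.act x v)) v ?_ (fun c m => ?_) (fun v w hv hw => ?_)
    · simp
    rotate_left
    · simp only [map_add, hv, hw]
    rw [hπι', (d.act x).map_smul, X.act, hπι', _root_.map_smul]
  · apply hΛ
    rw [← hπ, show πE v₀ = 0 from h0]
    simp

variable [Normal F E]

theorem coe_restrictNormalHom (γ : Gal(Fbar/F)) (c : E) :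
    ((AlgEquiv.restrictNormalHom E γ c : E) : Fbar) = γ c :=
  AlgEquiv.restrictNormal_commutes γ E c

/-- A twist isomorphism of a form extends to a twist isomorphism of the object. -/
theorem exists_extension (X : Form d E C) {γ : Gal(Fbar/F)} {s : X.M ≃ₗ[F] X.M}
    (hs : X.data.IsTwistIso (AlgEquiv.restrictNormalHom E γ) s) :
    ∃ S : V ≃ₗ[F] V, d.IsTwistIso γ S ∧ ∀ m, S (X.ι m) = X.ι (s m) := by
  have key : ∀ (γ : Gal(Fbar/F)) (s : X.M ≃ₗ[F] X.M),
      X.data.IsTwistIso (AlgEquiv.restrictNormalHom E γ) s →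
      ∃ S : V →ₗ[F] V, (∀ (c : Fbar) v, S (c • v) = γ c • S v) ∧ ∀ m, S (X.ι m) = X.ι (s m) := by
    intro γ s hs
    exact exists_semilinear_extension X.isBaseChange_ιE γ (X.ι ∘ₗ s.toLinearMap) (fun c m => by
      simp [hs.semilinear, X.map_smul, coe_restrictNormalHom])
  obtain ⟨S, hS, hSι⟩ := key γ s hs
  obtain ⟨T, hT, hTι⟩ := key γ⁻¹ s.symm (by rw [map_inv]; exact hs.symm)
  have hTS : ∀ v, T (S v) = v := fun v => by
    refine X.induction v (by simp) (fun m => by rw [hSι, hTι, s.symm_apply_apply])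
      (fun c v hv => ?_) (fun v w hv hw => by simp only [map_add, hv, hw])
    rw [hS, hT, hv]
    congr 1
    exact γ.symm_apply_apply c
  have hST : ∀ v, S (T v) = v := fun v => by
    refine X.induction v (by simp) (fun m => by rw [hTι, hSι, s.apply_symm_apply])
      (fun c v hv => ?_) (fun v w hv hw => by simp only [map_add, hv, hw])
    rw [hT, hS, hv]
    congr 1
    exact γ.apply_symm_apply c
  refine ⟨LinearEquiv.ofLinearMap S T (LinearMap.ext hST) (LinearMap.ext hTS),
    ⟨hS, fun v => ?_, fun x v => ?_⟩, hSι⟩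
  · change d.coact (S v) = S.rTensor A (d.coact v)
    refine X.induction v (by simp) (fun m => ?_) (fun c v hv => ?_)
      (fun v w hv hw => by simp only [map_add, hv, hw])
    · rw [hSι, X.coact, X.coact, hs.coact, ← LinearMap.comp_apply, ← LinearMap.comp_apply,
        ← LinearMap.rTensor_comp, ← LinearMap.rTensor_comp]
      congr 2
      ext m
      exact (hSι m).symm
    · rw [hS, _root_.map_smul, hv, _root_.map_smul, rTensor_semilinear γ S hS]
  · change S (d.act x v) = d.act x (S v)
    refine X.induction v (by simp) (fun m => ?_) (fun c v hv => ?_)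
      (fun v w hv hw => by simp only [map_add, hv, hw])
    · rw [hSι, X.act, X.act, hSι, hs.act]
    · simp only [_root_.map_smul, hS, hv]

/-- Up to a scalar, a twist isomorphism of the object maps a form to itself. -/
theorem exists_smul_mem (X : Form d E C) (hd : d.HasScalarEnd) [Nontrivial V] {γ : Gal(Fbar/F)}
    {t : V ≃ₗ[F] V} (ht : d.IsTwistIso γ t) :
    ∃ c : Fbar, c ≠ 0 ∧ ∀ m, ∃ m', c • t (X.ι m) = X.ι m' := by
  obtain ⟨m₀, hm₀⟩ := X.exists_ne_zero
  have hv₀ : t (X.ι m₀) ≠ 0 := by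
    simpa using (map_ne_zero_iff _ X.ι_injective).2 hm₀
  obtain ⟨π, hπ, hπc, hπa, hπ₀⟩ := X.exists_projection hv₀
  -- The `γ`-semilinearity of `t` cancels against that of its inverse, so `t⁻¹ ∘ ι ∘ π ∘ t ∘ ι` is
  -- `E`-linear and equivariant, hence equal to `c • ι`. Applying `t` gives `γ c • t ∘ ι = ι ∘ π ∘ t
  -- ∘ ι`.
  obtain ⟨c, hc⟩ := X.exists_eq_smul_ι hd
    (t.symm.toLinearMap ∘ₗ X.ι ∘ₗ π ∘ₗ t.toLinearMap ∘ₗ X.ι)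
    (fun c m => by
      simp only [LinearMap.comp_apply, LinearEquiv.coe_coe, X.map_smul, ht.semilinear]
      rw [← coe_restrictNormalHom, hπ, X.map_smul, ht.symm.semilinear, coe_restrictNormalHom]
      congr 1
      exact γ.symm_apply_apply _)
    (fun m => by
      simp only [LinearMap.comp_apply, LinearEquiv.coe_coe, ht.symm.coact, X.coact, hπc, ht.coact,
        LinearMap.rTensor_comp])
    (fun x m => by
      simp only [LinearMap.comp_apply, LinearEquiv.coe_coe]
      rw [← ht.symm.act, X.act, hπa, ← ht.act, X.act])
  have hc' : ∀ m, γ c • t (X.ι m) = X.ι (π (t (X.ι m))) := fun m => by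
    have := hc m
    simp only [LinearMap.comp_apply, LinearEquiv.coe_coe] at this
    rw [← ht.semilinear, ← this, t.apply_symm_apply]
  refine ⟨γ c, fun h0 => ?_, fun m => ⟨_, hc' m⟩⟩
  have := hc' m₀
  rw [h0, zero_smul] at this
  exact hπ₀ (X.ι_injective (by rw [← this, map_zero]))

/-- If the twist by `γ` of the object is isomorphic to the object, then the same holds for the
forms over normal extensions. -/
theorem exists_isTwistIso (X : Form d E C) (hd : d.HasScalarEnd) [Nontrivial V] {γ : Gal(Fbar/F)}
    (hγ : γ ∈ d.rationalityGroup) :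
    ∃ s, X.data.IsTwistIso (AlgEquiv.restrictNormalHom E γ) s := by
  obtain ⟨t₀, ht₀⟩ := hγ
  obtain ⟨c, hc0, hc⟩ := X.exists_smul_mem hd ht₀
  obtain ⟨t, ht, htt₀⟩ := ht₀.exists_smul hc0
  have hf : ∀ m, ∃ m', t (X.ι m) = X.ι m' := fun m => by simpa only [htt₀] using hc m
  obtain ⟨c', hc0', hc'⟩ := X.exists_smul_mem hd ht.symm
  obtain ⟨m₀, hm₀⟩ := X.exists_ne_zero
  -- Both `t` and `c' • t⁻¹` preserve the form, hence so does their composite, which is `γ c'`. Thus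
  -- `γ c'` lies in `E`, and `c'` does because `E` is normal. Consequently `t⁻¹` preserves the form
  -- without rescaling.
  obtain ⟨e, he⟩ : ∃ e : E, (e : Fbar) = c' := by
    obtain ⟨m₁, h₁⟩ := hc' m₀
    obtain ⟨m₂, h₂⟩ := hf m₁
    rw [← h₁, ht.semilinear, t.apply_symm_apply] at h₂
    obtain ⟨e, he⟩ := X.exists_eq_of_smul_eq hm₀ h₂
    refine ⟨AlgEquiv.restrictNormalHom E γ⁻¹ e, ?_⟩
    rw [coe_restrictNormalHom, he]
    exact γ.symm_apply_apply _
  have he0 : e ≠ 0 := fun h => hc0' (by rw [← he, h]; rfl)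
  have hg : ∀ m, ∃ m', t.symm (X.ι m) = X.ι m' := fun m => by
    obtain ⟨m', h'⟩ := hc' m
    refine ⟨e⁻¹ • m', ?_⟩
    rw [X.map_smul, ← h', ← he, smul_smul, ← IntermediateField.coe_mul, inv_mul_cancel₀ he0]
    simp
  choose f hf using hf
  choose g hg using hg
  let s : X.M ≃ₗ[F] X.M :=
    { toFun := f
      invFun := g
      map_add' := fun x y => X.ι_injective (by simp only [← hf, map_add])
      map_smul' := fun x y => X.ι_injective (by
        simp only [← hf, _root_.map_smul, RingHom.id_apply])
      left_inv := fun x => X.ι_injective (by rw [← hg, ← hf, t.symm_apply_apply])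
      right_inv := fun x => X.ι_injective (by rw [← hf, ← hg, t.apply_symm_apply]) }
  have hs : ∀ m, X.ι (s m) = t (X.ι m) := fun m => (hf m).symm
  refine ⟨s, fun c m => X.ι_injective ?_, fun m => X.rTensor_ι_injective ?_,
    fun x m => X.ι_injective ?_⟩
  · rw [hs, X.map_smul, X.map_smul, hs, ht.semilinear, coe_restrictNormalHom]
  · rw [← X.coact, hs, ht.coact, X.coact, ← LinearMap.comp_apply, ← LinearMap.comp_apply,
        ← LinearMap.rTensor_comp, ← LinearMap.rTensor_comp]
    congr 2
    ext m
    exact (hs m).symm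
  · rw [hs, ← X.act, ← X.act, hs, ht.act]

end Form

/-! ### Cocycles from projective families, and conjugation of homomorphisms -/

section Cocycle

variable {F A L : Type*} [Field F] [CommRing A] [HopfAlgebra F A] [AddCommGroup L] [Module F L]
  {E M : Type*} [Field E] [Algebra F E]
  [AddCommGroup M] [Module F M] [Module E M] [IsScalarTower F E M]

/-- A family of twist isomorphisms that is multiplicative up to scalars defines a 2-cocycle. -/
theorem exists_cocycle {d : EquivData F A L E M} {Δ : Subgroup Gal(E/F)} [DiscreteTopology Δ]
    [Nontrivial M] {s : Δ → (M ≃ₗ[F] M)} (hs : ∀ σ : Δ, d.IsTwistIso σ (s σ))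
    (hmul : ∀ σ τ : Δ, ∃ c : E, ∀ m, s σ (s τ m) = c • s (σ * τ) m) :
    ∃ b : contCocycles2 Δ Eˣ, ∀ (σ τ : Δ) (m : M), s σ (s τ m) = (b.1 (σ, τ) : E) • s (σ * τ) m := by
  choose c hc using hmul
  obtain ⟨m₀, hm₀⟩ := exists_ne (0 : M)
  have hne : ∀ σ, s σ m₀ ≠ 0 := fun σ => by simpa using hm₀
  have hc0 : ∀ σ τ, c σ τ ≠ 0 := fun σ τ h => by
    have := hc σ τ m₀
    rw [h, zero_smul, LinearEquiv.map_eq_zero_iff] at this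
    exact hne τ this
  refine ⟨⟨fun p => Units.mk0 (c p.1 p.2) (hc0 _ _), IsLocallyConstant.of_discrete _,
    fun g h j => Units.ext ?_⟩, fun σ τ m => hc σ τ m⟩
  change c (g * h) j * c g h = (g : Gal(E/F)) (c h j) * c g (h * j)
  -- The cocycle identity is associativity of `s g ∘ s h ∘ s j`, read off on the nonzero vector `s
  -- (g * h * j) m₀`.
  refine smul_left_injective _ (hne (g * h * j)) ?_
  simp only
  rw [mul_comm, mul_smul, mul_smul, ← hc, ← hc, hc h j, (hs g).semilinear, hc g (h * j), mul_assoc]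

end Cocycle

section Conj

variable {F A L L' k V V' : Type*} [Field F] [CommRing A] [HopfAlgebra F A]
  [AddCommGroup L] [Module F L] [AddCommGroup L'] [Module F L'] [Field k] [Algebra F k]
  [AddCommGroup V] [Module F V] [Module k V] [IsScalarTower F k V]
  [AddCommGroup V'] [Module F V'] [Module k V'] [IsScalarTower F k V']

theorem id_mem_homK (d : EquivData F A L k V) : LinearMap.id ∈ d.homK d := fun v => by
  rw [show (LinearMap.id : V →ₗ[k] V).restrictScalars F = LinearMap.id from rfl]
  simp

/-- Twist isomorphisms act on homomorphisms of representations by conjugation. -/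
theorem exists_conj {d : EquivData F A L k V} {d' : EquivData F A L' k V'} {σ : Gal(k/F)}
    {s : V ≃ₗ[F] V} {t : V' ≃ₗ[F] V'} (hs : d.IsTwistIso σ s) (ht : d'.IsTwistIso σ t)
    {φ : V' →ₗ[k] V} (hφ : φ ∈ d'.homK d) :
    ∃ f ∈ d'.homK d, ∀ v, f v = s (φ (t.symm v)) := by
  let f : V' →ₗ[k] V :=
    { toFun := fun v => s (φ (t.symm v))
      map_add' := fun v w => by simp
      map_smul' := fun c v => by
        rw [ht.symm.semilinear, map_smul, hs.semilinear]
        congr 1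
        exact σ.apply_symm_apply c }
  refine ⟨f, fun v => ?_, fun v => rfl⟩
  have hf : f.restrictScalars F = s.toLinearMap ∘ₗ φ.restrictScalars F ∘ₗ t.symm.toLinearMap := rfl
  rw [hf, LinearMap.rTensor_comp, LinearMap.rTensor_comp, LinearMap.comp_apply,
    LinearMap.comp_apply, ← ht.symm.coact, ← hφ, ← hs.coact]
  rfl

/-- When all endomorphisms are scalars, two twist isomorphisms agree up to a scalar. -/
theorem HasScalarEnd.exists_eq_smul {d : EquivData F A L k V} (hd : d.HasScalarEnd)
    [Nontrivial V] {σ : Gal(k/F)} {s t : V ≃ₗ[F] V} (hs : d.IsTwistIso σ s)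
    (ht : d.IsTwistIso σ t) : ∃ c : kˣ, ∀ v, s v = (c : k) • t v := by
  -- Conjugating the identity gives the linear endomorphism `s ∘ t⁻¹`, a scalar by hypothesis.
  obtain ⟨f, hf, hfv⟩ := exists_conj hs ht d.id_mem_homK
  obtain ⟨c, hc⟩ := hd f hf (fun x v => by
    simp only [hfv, LinearMap.id_apply]
    rw [← hs.act, ht.symm.act])
  have hc' : ∀ v, s v = c • t v := fun v => by
    rw [← hc, hfv]
    simp
  obtain ⟨v, hv⟩ := exists_ne (0 : V)
  have hc0 : c ≠ 0 := fun h => hv (by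
    have := hc' v
    rwa [h, zero_smul, LinearEquiv.map_eq_zero_iff] at this)
  exact ⟨Units.mk0 c hc0, hc'⟩

end Conj

/-! ### Existence and uniqueness of Borel–Tits classes, given a form -/

section Classes

variable {F A L : Type*} [Field F] [CommRing A] [HopfAlgebra F A] [AddCommGroup L] [Module F L]
variable {Fbar : Type*} [Field Fbar] [Algebra F Fbar]
variable {V : Type w} [AddCommGroup V] [Module F V] [Module Fbar V] [IsScalarTower F Fbar V]
  {d : EquivData F A L Fbar V}

/-- Each `s σ ∘ s τ ∘ (s (σ * τ))⁻¹` is an `E`-linear endomorphism of the form, hence a scalar in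
`E`. -/
theorem Form.exists_isFiniteBorelTitsClass {E : IntermediateField F Fbar}
    {C : ∀ (M : Type w) [AddCommGroup M] [Module F M] [Module E M] [IsScalarTower F E M],
      EquivData F A L E M → Prop} [FiniteDimensional F E] [Normal F E]
    (X : Form d E C) (hd : d.HasScalarEnd) [Nontrivial V] :
    ∃ c, IsFiniteBorelTitsClass X.data (restrictGal E d.rationalityGroup) c := by
  have h : ∀ σ : restrictGal E d.rationalityGroup, ∃ s, X.data.IsTwistIso σ s := by
    rintro ⟨_, γ, hγ, rfl⟩
    exact X.exists_isTwistIso hd hγ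
  choose s hs using h
  obtain ⟨m₀, hm₀⟩ := X.exists_ne_zero
  have : Nontrivial X.M := ⟨m₀, 0, hm₀⟩
  obtain ⟨b, hb⟩ := exists_cocycle hs (fun σ τ => by
    have h₁ := (hs σ).comp (hs τ)
    have h₂ := hs (σ * τ)
    let f := ((s (σ * τ)).symm.trans ((s τ).trans (s σ))).toLinearMap
    have h₃ := h₂.symm
    obtain ⟨c, hc⟩ := X.exists_scalar_end hd f (fun c m => by
        change s σ (s τ ((s (σ * τ)).symm (c • m))) = c • s σ (s τ ((s (σ * τ)).symm m))
        rw [h₃.semilinear]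
        refine (h₁.semilinear _ _).trans ?_
        congr 1
        exact AlgEquiv.apply_symm_apply (σ * τ : Gal(E/F)) c)
      (fun m => by
        change X.data.coact (((s τ).trans (s σ)) ((s (σ * τ)).symm m)) = _
        rw [h₁.coact, h₃.coact, ← LinearMap.comp_apply, ← LinearMap.rTensor_comp]
        rfl)
      (fun x m => by
        change _ = ((s τ).trans (s σ)) ((s (σ * τ)).symm (X.data.act x m))
        rw [h₃.act, h₁.act]
        rfl)
    refine ⟨c, fun m => ?_⟩
    rw [← hc]
    change _ = s σ (s τ ((s (σ * τ)).symm (s (σ * τ) m)))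
    rw [LinearEquiv.symm_apply_apply])
  exact ⟨_, s, hs, b, rfl, hb⟩

/-- Extending `s` of the restriction of `γ` to `E` in a `γ`-semilinear way turns the class of a form
into data on `V` itself, where systems from different fields `E` can be compared. -/
theorem Form.exists_isTwistSystem [Algebra.IsIntegral F Fbar] {E : IntermediateField F Fbar}
    {C : ∀ (M : Type w) [AddCommGroup M] [Module F M] [Module E M] [IsScalarTower F E M],
      EquivData F A L E M → Prop} [FiniteDimensional F E] [Normal F E]
    (X : Form d E C) {Γ : Subgroup Gal(Fbar/F)} {c : ContH2 (restrictGal E Γ) Eˣ}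
    (hc : IsFiniteBorelTitsClass X.data (restrictGal E Γ) c) :
    ∃ (S : Γ → (V ≃ₗ[F] V)) (b : contCocycles2 Γ Fbarˣ), d.IsTwistSystem S b ∧
      (QuotientGroup.mk b : ContH2 Γ Fbarˣ) = inflation E Γ c := by
  obtain ⟨s, hs, b, rfl, hb⟩ := hc
  let r : Γ →* restrictGal E Γ := (AlgEquiv.restrictNormalHom E).subgroupMap Γ
  have hr : Continuous r := Continuous.subtype_mk
    ((InfiniteGalois.restrictNormalHom_continuous E).comp continuous_subtype_val) _
  have h : ∀ γ : Γ, ∃ S : V ≃ₗ[F] V, d.IsTwistIso γ S ∧ ∀ m, S (X.ι m) = X.ι (s (r γ) m) :=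
    fun γ => X.exists_extension (hs (r γ))
  choose S hS hSι using h
  refine ⟨S, contCocycles2Map r hr (Units.map (algebraMap E Fbar)) (by
      intro γ m
      ext
      exact AlgEquiv.restrictNormal_commutes γ.1 E (m : E)) b, ⟨hS, fun v => ?_, fun γ δ v => ?_⟩,
    rfl⟩
  · refine X.induction v ?_ (fun m => ?_) (fun c v hv => ?_) (fun v w hv hw => ?_)
    · simp only [map_zero]
      exact IsLocallyConstant.const 0
    · simp only [hSι]
      -- On the form, `S γ` depends only on the image of `γ` in a finite discrete group.
      exact (IsLocallyConstant.of_discrete (fun σ => X.ι (s σ m))).comp_continuous hr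
    · simp only [(hS _).semilinear]
      exact ((isLocallyConstant_galois_apply c).comp_continuous continuous_subtype_val).comp₂ hv
        (fun a w => a • w)
    · simp only [map_add]
      exact hv.comp₂ hw (fun a w => a + w)
  · refine X.induction v ?_ (fun m => ?_) (fun c v hv => ?_) (fun v w hv hw => ?_)
    · simp
    · rw [hSι, hSι, hSι, hb, X.map_smul, map_mul]
      rfl
    · rw [(hS δ).semilinear, (hS γ).semilinear, hv, (hS (γ * δ)).semilinear, smul_comm]
      rfl
    · simp only [map_add, smul_add, hv, hw]

/-- An object with scalar endomorphisms and a form over a finite Galois extension has exactly one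
Borel–Tits class. -/
theorem exists_isTwistSystem_of_form [Algebra.IsIntegral F Fbar]
    (C : ∀ (E : IntermediateField F Fbar) (M : Type w) [AddCommGroup M] [Module F M] [Module E M]
      [IsScalarTower F E M], EquivData F A L E M → Prop)
    (hd : d.HasScalarEnd) [Nontrivial V] (E : IntermediateField F Fbar) [FiniteDimensional F E]
    [IsGalois F E] (X : Form d E (C E)) :
    ∃ (S : d.rationalityGroup → (V ≃ₗ[F] V)) (b : contCocycles2 d.rationalityGroup Fbarˣ),
      d.IsTwistSystem S b ∧ ∀ c, d.IsBorelTitsClass C c ↔ c = QuotientGroup.mk b := by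
  obtain ⟨c₀, hc₀⟩ := X.exists_isFiniteBorelTitsClass hd
  obtain ⟨S, b, hS, hb⟩ := X.exists_isTwistSystem hc₀
  refine ⟨S, b, hS, fun c => ⟨?_, ?_⟩⟩
  · rintro ⟨-, E', _, _, X', c', hc', rfl⟩
    obtain ⟨T, b', hT, hb'⟩ := X'.exists_isTwistSystem hc'
    have hy : ∀ γ, ∃ y : Fbarˣ, ∀ v, T γ v = (y : Fbar) • S γ v := fun γ =>
      hd.exists_eq_smul (hT.twist γ) (hS.twist γ)
    choose y hy using hy
    rw [← hb']
    refine hT.class_eq hS LinearMap.id (fun h => ?_) y hy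
    obtain ⟨v, hv⟩ := exists_ne (0 : V)
    exact hv (LinearMap.congr_fun h v)
  · rintro rfl
    exact ⟨hd, E, inferInstance, inferInstance, X, c₀, hc₀, hb⟩

/-- If an object `V'` occurs in `V` with multiplicity one, then twist systems of `V` and `V'` have
the same class. -/
theorem IsTwistSystem.class_eq_of_finrank_homK {L' V' : Type*} [AddCommGroup L'] [Module F L']
    [AddCommGroup V'] [Module F V'] [Module Fbar V'] [IsScalarTower F Fbar V']
    {d' : EquivData F A L' Fbar V'} (hmult : Module.finrank Fbar (d'.homK d) = 1)
    {Γ : Subgroup Gal(Fbar/F)} {S : Γ → (V ≃ₗ[F] V)} {T : Γ → (V' ≃ₗ[F] V')}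
    {b b' : contCocycles2 Γ Fbarˣ} (hS : d.IsTwistSystem S b) (hT : d'.IsTwistSystem T b') :
    (QuotientGroup.mk b : ContH2 Γ Fbarˣ) = QuotientGroup.mk b' := by
  obtain ⟨⟨φ, hφ⟩, hφ0, hφ1⟩ := finrank_eq_one_iff'.1 hmult
  have hφ0' : φ ≠ 0 := fun h => hφ0 (Subtype.ext h)
  have hy : ∀ γ, ∃ y : Fbarˣ, ∀ v, S γ (φ v) = (y : Fbar) • φ (T γ v) := by
    intro γ
    -- The conjugate `S γ ∘ φ ∘ (T γ)⁻¹` lies in the one-dimensional space spanned by `φ`.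
    obtain ⟨f, hf, hfv⟩ := exists_conj (hS.twist γ) (hT.twist γ) hφ
    obtain ⟨c, hc⟩ := hφ1 ⟨f, hf⟩
    have hc' : ∀ v, S γ (φ v) = c • φ (T γ v) := fun v => by
      have e : c • φ = f := congrArg Subtype.val hc
      rw [← LinearMap.smul_apply, e, hfv, LinearEquiv.symm_apply_apply]
    refine ⟨Units.mk0 c fun h => hφ0' (LinearMap.ext fun v => ?_), hc'⟩
    have := hc' v
    rwa [h, zero_smul, LinearEquiv.map_eq_zero_iff] at this
  choose y hy using hy
  exact hS.class_eq hT φ hφ0' y hy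

end Classes

/-! ### Module axioms on subobjects over smaller fields -/

section Transfer

variable {F A L k K V M : Type*} [Field F] [CommRing A] [HopfAlgebra F A]
  [AddCommGroup L] [Module F L] [Field k] [Algebra F k] [Field K] [Algebra F K]
  [AddCommGroup M] [Module F M] [Module k M] [IsScalarTower F k M]
  [AddCommGroup V] [Module F V] [Module K V] [IsScalarTower F K V]

theorem map_rid_lTensor (ι : M →ₗ[F] V) (D : Module.Dual F A) (t : M ⊗[F] A) :
    ι (TensorProduct.rid F M (D.lTensor M t)) =
      TensorProduct.rid F V (D.lTensor V (ι.rTensor A t)) := by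
  induction t with
  | zero => simp
  | add s t hs ht => simp only [map_add, hs, ht]
  | tmul s a => simp

/-- A comodule structure is inherited along injective equivariant maps. -/
theorem isCoaction_of_injective {d' : EquivData F A L k M} {d : EquivData F A L K V}
    {ι : M →ₗ[F] V} (hι : Function.Injective ι)
    (hcoact : ∀ m, d.coact (ι m) = ι.rTensor A (d'.coact m)) (h : IsCoaction d.coactF) :
    IsCoaction d'.coactF := by
  have hc : ∀ m, d.coactF (ι m) = ι.rTensor A (d'.coactF m) := hcoact
  refine ⟨fun m => hι ?_, fun m => ?_⟩
  · rw [map_rid_lTensor, ← hc, h.counit]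
  · apply Module.Flat.rTensor_preserves_injective_linearMap (M := A ⊗[F] A) ι hι
    have h₁ : ∀ s : M ⊗[F] A, ∀ a : A,
        ι.rTensor (A ⊗[F] A) (TensorProduct.assoc F M A A (s ⊗ₜ a)) =
          TensorProduct.assoc F V A A (ι.rTensor A s ⊗ₜ a) := by
      intro s a
      induction s with
      | zero => simp
      | add s t hs ht => simp only [map_add, TensorProduct.add_tmul, hs, ht]
      | tmul s b => simp
    have h₂ : ∀ t : M ⊗[F] A,
        ι.rTensor (A ⊗[F] A) (TensorProduct.assoc F M A A (d'.coactF.rTensor A t)) =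
          TensorProduct.assoc F V A A (d.coactF.rTensor A (ι.rTensor A t)) := by
      intro t
      induction t with
      | zero => simp
      | add s t hs ht => simp only [map_add, hs, ht]
      | tmul s a => simp only [LinearMap.rTensor_tmul, h₁, hc]
    rw [h₂, ← hc, h.coassoc, hc, ← LinearMap.comp_apply, LinearMap.lTensor_comp_rTensor,
      ← LinearMap.rTensor_comp_lTensor]
    rfl

/-- The axioms of a `(𝔤, K)`-module are inherited along injective equivariant maps. -/
theorem isGKModule_of_injective {g : Type*} [LieRing g] [LieAlgebra F g] {P : HCPair F A g}
    {d' : EquivData F A g k M} {d : EquivData F A g K V} {ι : M →ₗ[F] V}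
    (hι : Function.Injective ι) (hcoact : ∀ m, d.coact (ι m) = ι.rTensor A (d'.coact m))
    (hact : ∀ x m, d.act x (ι m) = ι (d'.act x m)) (h : d.IsGKModule P) : d'.IsGKModule P := by
  refine ⟨isCoaction_of_injective hι hcoact h.isCoaction, fun x y m => hι ?_, fun x m => ?_,
    fun D m => hι ?_⟩
  · rw [map_sub, ← hact, ← hact, ← hact, ← hact, ← hact, h.lie]
  · apply Module.Flat.rTensor_preserves_injective_linearMap (M := A) ι hι
    have h₁ : ∀ (s : g ⊗[F] A) (t : M ⊗[F] A),
        ι.rTensor A (TensorProduct.map₂ d'.actF (LinearMap.mul F A) s t) =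
          TensorProduct.map₂ d.actF (LinearMap.mul F A) s (ι.rTensor A t) := by
      intro s t
      induction s with
      | zero => simp
      | add s s' hs hs' => simp only [map_add, LinearMap.add_apply, hs, hs']
      | tmul y a =>
        induction t with
        | zero => simp
        | add t t' ht ht' => simp only [map_add, ht, ht']
        | tmul m b =>
          simp only [TensorProduct.map₂_apply_tmul, TensorProduct.map_tmul, LinearMap.rTensor_tmul]
          rw [show d.actF y (ι m) = ι (d'.actF y m) from hact y m]
    rw [← hcoact, ← hact, h.equivariant, hcoact, h₁]
  · rw [map_rid_lTensor, ← hcoact, h.differential, hact]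

end Transfer

/-! ### Stable subspaces over a subfield -/

section Restrict

variable {F A k V : Type*} [Field F] [CommRing A] [HopfAlgebra F A] [Field k] [Algebra F k]
  [AddCommGroup V] [Module F V] [Module k V] [IsScalarTower F k V]

/-- The subspace `W ⊗ F[K]` of `V ⊗ F[K]`. -/
def tensorRange (A : Type*) [CommRing A] [HopfAlgebra F A] (W : Submodule k V) :
    Submodule F (V ⊗[F] A) :=
  LinearMap.range ((W.subtype.restrictScalars F).rTensor A)

theorem tmul_mem_tensorRange {W : Submodule k V} {v : V} (hv : v ∈ W) (a : A) :
    v ⊗ₜ[F] a ∈ tensorRange A W :=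
  ⟨(⟨v, hv⟩ : W) ⊗ₜ a, rfl⟩

@[elab_as_elim]
theorem tensorRange_induction {W : Submodule k V} {p : V ⊗[F] A → Prop} {t : V ⊗[F] A}
    (ht : t ∈ tensorRange A W) (zero : p 0) (tmul : ∀ v ∈ W, ∀ a : A, p (v ⊗ₜ a))
    (add : ∀ s t, p s → p t → p (s + t)) : p t := by
  obtain ⟨t, rfl⟩ := ht
  induction t with
  | zero => simpa using zero
  | add s t hs ht => simpa using add _ _ hs ht
  | tmul w a => exact tmul w w.2 a

theorem smul_mem_tensorRange {W : Submodule k V} {t : V ⊗[F] A} (ht : t ∈ tensorRange A W)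
    (c : k) : c • t ∈ tensorRange A W := by
  refine tensorRange_induction ht ?_ (fun v hv a => ?_) (fun s t hs ht => ?_)
  · simp
  · rw [TensorProduct.smul_tmul']
    exact tmul_mem_tensorRange (W.smul_mem c hv) a
  · rw [smul_add]
    exact add_mem hs ht

variable {L K : Type*} [AddCommGroup L] [Module F L] [Field K] [Algebra F K]
  [Module K V] [IsScalarTower F K V]

/-- A subspace over a subfield `k` that is stable under `K` and `L`. -/
def IsStableOver (d : EquivData F A L K V) (W : Submodule k V) : Prop :=
  (∀ v ∈ W, d.coact v ∈ tensorRange A W) ∧ ∀ (x : L), ∀ v ∈ W, d.act x v ∈ W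

variable [Algebra k K] [IsScalarTower k K V]

theorem isStableOver_span {d : EquivData F A L K V} {R : Set V}
    (hc : ∀ v ∈ R, d.coact v ∈ tensorRange A (Submodule.span k R))
    (ha : ∀ (x : L), ∀ v ∈ R, d.act x v ∈ Submodule.span k R) :
    d.IsStableOver (Submodule.span k R) := by
  refine ⟨fun v hv => ?_, fun x v hv => ?_⟩
  · induction hv using Submodule.span_induction with
    | mem v hv => exact hc v hv
    | zero => simp
    | add v w _ _ hv hw => rw [map_add]; exact add_mem hv hw
    | smul c v _ hv =>
      rw [LinearMap.map_smul_of_tower]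
      exact smul_mem_tensorRange hv c
  · induction hv using Submodule.span_induction with
    | mem v hv => exact ha x v hv
    | zero => simp
    | add v w _ _ hv hw => rw [map_add]; exact add_mem hv hw
    | smul c v _ hv =>
      rw [LinearMap.map_smul_of_tower]
      exact Submodule.smul_mem _ c hv

omit [Algebra k K] [IsScalarTower k K V] in
/-- The span over `K` of a stable subspace is stable. -/
theorem IsStableOver.isStable_span {d : EquivData F A L K V} {W : Submodule k V}
    (h : d.IsStableOver W) : d.IsStable (Submodule.span K (W : Set V)) := by
  have : d.IsStableOver (Submodule.span K (W : Set V)) := by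
    refine isStableOver_span (fun v hv => ?_) (fun x v hv => Submodule.subset_span (h.2 x v hv))
    exact tensorRange_induction (h.1 v hv) (zero_mem _)
      (fun v hv a => tmul_mem_tensorRange (Submodule.subset_span hv) a) (fun s t hs ht => add_mem hs ht)
  exact this

/-- The operators on a stable subspace over `k`. -/
noncomputable def restrictData (d : EquivData F A L K V) (W : Submodule k V)
    (h : d.IsStableOver W) : EquivData F A L k W :=
  have hinj : Function.Injective ((W.subtype.restrictScalars F).rTensor A) :=
    Module.Flat.rTensor_preserves_injective_linearMap _ W.injective_subtype
  have hsmul : ∀ (c : k) (t : W ⊗[F] A), (W.subtype.restrictScalars F).rTensor A (c • t) =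
      c • (W.subtype.restrictScalars F).rTensor A t :=
    fun c t => rTensor_semilinear id _ (fun c v => rfl) c t
  { coact :=
      { toFun := fun w => (h.1 w w.2).choose
        map_add' := fun v w => hinj (by
          rw [map_add, (h.1 v v.2).choose_spec, (h.1 w w.2).choose_spec,
            (h.1 _ (v + w).2).choose_spec]
          exact map_add d.coact _ _)
        map_smul' := fun c w => hinj (by
          rw [hsmul, (h.1 w w.2).choose_spec, (h.1 _ (c • w).2).choose_spec]
          exact LinearMap.map_smul_of_tower d.coact c (w : V)) }
    act :=
      { toFun := fun x =>
          { toFun := fun w => ⟨d.act x w, h.2 x w w.2⟩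
            map_add' := fun v w => Subtype.ext (map_add (d.act x) _ _)
            map_smul' := fun c w => Subtype.ext (LinearMap.map_smul_of_tower (d.act x) c (w : V)) }
        map_add' := fun x y => LinearMap.ext fun w => Subtype.ext (by simp)
        map_smul' := fun c x => LinearMap.ext fun w => Subtype.ext (by simp) } }

theorem restrictData_coact (d : EquivData F A L K V) (W : Submodule k V) (h : d.IsStableOver W)
    (w : W) : d.coact (W.subtype.restrictScalars F w) =
      (W.subtype.restrictScalars F).rTensor A ((d.restrictData W h).coact w) :=
  (h.1 w w.2).choose_spec.symm

theorem restrictData_act (d : EquivData F A L K V) (W : Submodule k V) (h : d.IsStableOver W)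
    (x : L) (w : W) : d.act x (W.subtype.restrictScalars F w) =
      W.subtype.restrictScalars F ((d.restrictData W h).act x w) :=
  rfl

end Restrict

/-! ### Forms spanned by a basis, and finite fields of definition -/

section MakeForm

variable {F A L : Type*} [Field F] [CommRing A] [HopfAlgebra F A] [AddCommGroup L] [Module F L]
variable {Fbar : Type*} [Field Fbar] [Algebra F Fbar]
variable {V : Type w} [AddCommGroup V] [Module F V] [Module Fbar V] [IsScalarTower F Fbar V]
  {d : EquivData F A L Fbar V}

omit [Module F V] [IsScalarTower F Fbar V] in
theorem isBaseChange_span_basis {κ : Type*} (b : Module.Basis κ Fbar V)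
    (E : IntermediateField F Fbar) :
    IsBaseChange Fbar (Submodule.span E (Set.range b)).subtype := by
  have hli : LinearIndependent E b := b.linearIndependent.restrict_scalars' E
  let e := (Module.Basis.span hli).repr
  have h := IsBaseChange.comp_equiv e _ (IsBaseChange.of_basis E b)
  convert h using 1
  ext v
  have := congrArg Subtype.val ((Module.Basis.span hli).linearCombination_repr v)
  rw [Finsupp.linearCombination_apply, Finsupp.sum] at this
  rw [LinearMap.comp_apply]
  change (v : V) = Finsupp.linearCombination E b ((Module.Basis.span hli).repr v)
  rw [Finsupp.linearCombination_apply, Finsupp.sum]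
  refine this.symm.trans ?_
  simp [Module.Basis.span_apply]

/-- A stable `E`-subspace spanned by a basis of `V` is an `E`-form of `V`. -/
theorem exists_form_of_isStableOver {κ : Type*} (b : Module.Basis κ Fbar V)
    {E : IntermediateField F Fbar} [IsScalarTower F E V]
    (h : d.IsStableOver (Submodule.span E (Set.range b)))
    {C : ∀ (M : Type w) [AddCommGroup M] [Module F M] [Module E M] [IsScalarTower F E M],
      EquivData F A L E M → Prop}
    (hC : C _ (d.restrictData _ h)) : Nonempty (Form d E C) :=
  ⟨{ M := Submodule.span E (Set.range b)
     data := d.restrictData _ h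
     isObject := hC
     ι := (Submodule.span E (Set.range b)).subtype.restrictScalars F
     map_smul := fun _ _ => rfl
     isBaseChange := isBaseChange_span_basis b E
     coact := restrictData_coact d _ h
     act := restrictData_act d _ h }⟩

omit [Module F V] [IsScalarTower F Fbar V] in
/-- Finitely many scalars suffice to express an element of a span. -/
theorem exists_finite_mem_span {R : Set V} {v : V} (hv : v ∈ Submodule.span Fbar R) :
    ∃ S : Set Fbar, S.Finite ∧ ∀ E : IntermediateField F Fbar, S ⊆ E → v ∈ Submodule.span E R := by
  induction hv using Submodule.span_induction with
  | mem v hv => exact ⟨∅, Set.finite_empty, fun E _ => Submodule.subset_span hv⟩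
  | zero => exact ⟨∅, Set.finite_empty, fun E _ => zero_mem _⟩
  | add v w _ _ hv hw =>
    obtain ⟨S, hS, h⟩ := hv
    obtain ⟨T, hT, h'⟩ := hw
    exact ⟨S ∪ T, hS.union hT, fun E hE =>
      add_mem (h E (Set.subset_union_left.trans hE)) (h' E (Set.subset_union_right.trans hE))⟩
  | smul c v _ hv =>
    obtain ⟨S, hS, h⟩ := hv
    refine ⟨insert c S, hS.insert c, fun E hE => ?_⟩
    have hc : c ∈ E := hE (Set.mem_insert c S)
    exact Submodule.smul_mem _ (⟨c, hc⟩ : E) (h E ((Set.subset_insert c S).trans hE))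

/-- Finitely many scalars suffice to express an element of `V ⊗ F[K]`. -/
theorem exists_finite_mem_tensorRange {V' : Type*} [AddCommGroup V'] [Module F V'] [Module Fbar V']
    [IsScalarTower F Fbar V'] (φ : V' →ₗ[Fbar] V) {R : Set V'}
    (hR : Submodule.span Fbar R = ⊤) (t : V' ⊗[F] A) :
    ∃ S : Set Fbar, S.Finite ∧ ∀ (E : IntermediateField F Fbar) [IsScalarTower F E V], S ⊆ E →
      ∀ W : Submodule E V, (∀ r ∈ R, φ r ∈ W) → (φ.restrictScalars F).rTensor A t ∈ tensorRange A W := by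
  induction t with
  | zero => exact ⟨∅, Set.finite_empty, fun E _ _ W _ => by rw [map_zero]; exact zero_mem _⟩
  | add s t hs ht =>
    obtain ⟨S, hS, h⟩ := hs
    obtain ⟨T, hT, h'⟩ := ht
    refine ⟨S ∪ T, hS.union hT, fun E _ hE W hW => ?_⟩
    rw [map_add]
    exact add_mem (h E (Set.subset_union_left.trans hE) W hW)
      (h' E (Set.subset_union_right.trans hE) W hW)
  | tmul v a =>
    obtain ⟨S, hS, h⟩ := exists_finite_mem_span (F := F)
      (hR ▸ Submodule.mem_top : v ∈ Submodule.span Fbar R)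
    refine ⟨S, hS, fun E _ hE W hW => ?_⟩
    rw [LinearMap.rTensor_tmul]
    refine tmul_mem_tensorRange ?_ a
    have hv := h E hE
    clear h
    induction hv using Submodule.span_induction with
    | mem v hv => exact hW v hv
    | zero => simp
    | add v w _ _ hv hw => rw [map_add]; exact add_mem hv hw
    | smul c v _ hv => exact (φ.map_smul_of_tower c v) ▸ W.smul_mem c hv

end MakeForm

end EquivData

/-! ### Standard monomials -/

section Standard

variable {k K V I : Type*} [Field k] [Field K] [Algebra k K] [AddCommGroup V] [Module k V]
  [Module K V] [IsScalarTower k K V] [LinearOrder I]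

/-- The indices `p` for which `e p` is not in the span of the preceding vectors. -/
def standardIndices (K : Type*) {V I : Type*} [Field K] [AddCommGroup V] [Module K V]
    [LinearOrder I] (e : I → V) : Set I :=
  {p | e p ∉ Submodule.span K (e '' Set.Iio p)}

/-- In a finite set of standard indices, the vector at the largest index lies outside the span of
the others; induct on the maximum. -/
theorem linearIndepOn_standardIndices (e : I → V) :
    LinearIndepOn K e (standardIndices K e) := by
  refine linearIndepOn_of_finite _ fun t ht hfin => ?_
  obtain ⟨t, rfl⟩ := hfin.exists_finset_coe
  clear hfin
  induction t using Finset.induction_on_max with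
  | empty => simp
  | insert p s hp ih =>
    rw [Finset.coe_insert, linearIndepOn_insert (fun h => lt_irrefl p (hp p h))]
    rw [Finset.coe_insert, Set.insert_subset_iff] at ht
    exact ⟨ih ht.2, fun h => ht.1 (Submodule.span_mono (Set.image_mono fun q hq => hp q hq) h)⟩

theorem mem_span_image_of_wellFounded [WellFoundedLT I] (e : I → V) (T : Set I)
    (h : ∀ p ∉ T, e p ∈ Submodule.span k (e '' Set.Iio p)) (p : I) :
    e p ∈ Submodule.span k (e '' T) := by
  induction p using WellFoundedLT.induction with
  | ind p ih =>
    by_cases hp : p ∈ T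
    · exact Submodule.subset_span ⟨p, hp, rfl⟩
    · refine Submodule.span_le.2 ?_ (h p hp)
      rintro _ ⟨q, hq, rfl⟩
      exact ih q hq

end Standard

/-! ### Propagation of relations along leading terms -/

section Descent

variable {F Fbar V I κ : Type*} [Field F] [Field Fbar] [Algebra F Fbar] [AddCommGroup V]
  [Module F V] [Module Fbar V] [IsScalarTower F Fbar V] [LinearOrder I]

/-- Suppose that `X k (e p) ≡ e (shift k p)` modulo vectors of smaller degree, and that a set of
indices closed under the shifts is finitely generated. Then the linear relations that express the
nonstandard vectors `e p` are defined over any subfield containing a certain finite set. -/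
theorem exists_finite_forall_mem_span (deg : I → ℕ) (hdeg : Monotone deg) (shift : κ → I → I)
    (hshift : ∀ k, StrictMono (shift k)) (hdegs : ∀ k p, deg (shift k p) = deg p + 1)
    (hfin : ∀ N : Set I, ∃ T ⊆ N, T.Finite ∧ ∀ P : I → Prop, (∀ t ∈ T, P t) →
      (∀ k p, P p → P (shift k p)) → ∀ p ∈ N, P p)
    (e : I → V) (X : κ → V →ₗ[Fbar] V)
    (hX : ∀ k p, X k (e p) - e (shift k p) ∈ Submodule.span F (e '' {q | deg q ≤ deg p})) :
    ∃ S : Set Fbar, S.Finite ∧ ∀ E : IntermediateField F Fbar, S ⊆ E →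
      ∀ p ∉ standardIndices Fbar e, e p ∈ Submodule.span E (e '' Set.Iio p) := by
  -- Only the relations at the finitely many generators `T` of the nonstandard indices contribute
  -- scalars; all others are deduced from them by shifting.
  obtain ⟨T, hTN, hT, hgen⟩ := hfin (standardIndices Fbar e)ᶜ
  have hc : ∀ t : T, ∃ S : Set Fbar, S.Finite ∧ ∀ E : IntermediateField F Fbar, S ⊆ E →
      e t ∈ Submodule.span E (e '' Set.Iio t.1) := fun t =>
    EquivData.exists_finite_mem_span (not_not.1 (hTN t.2))
  choose S hS hSE using hc
  have : Finite T := hT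
  refine ⟨⋃ t, S t, Set.finite_iUnion hS, fun E hE => ?_⟩
  have hFE : ∀ (R : Set V) v, v ∈ Submodule.span F R → v ∈ Submodule.span E R := by
    intro R v hv
    have := EquivData.isScalarTower_intermediateField E V
    exact Submodule.span_le_restrictScalars F E R hv
  have hlt : ∀ k p q, deg q ≤ deg p → q < shift k p := by
    intro k p q hq
    by_contra! h
    have := hdeg h
    rw [hdegs] at this
    omega
  refine hgen _ (fun t ht => hSE ⟨t, ht⟩ E ((Set.subset_iUnion S _).trans hE)) fun k p hp => ?_
  -- The error terms have degree at most `deg p`, which is less than the degree of `shift k p`, and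
  -- their coefficients are in `F`; so they are harmless over every `E`.
  have hlow : ∀ q ≤ p, X k (e q) - e (shift k q) ∈ Submodule.span E (e '' Set.Iio (shift k p)) := by
    intro q hq
    refine Submodule.span_mono (Set.image_mono fun r hr => ?_) (hFE _ _ (hX k q))
    exact hlt k p r (le_trans hr (hdeg hq))
  have hXp : X k (e p) ∈ Submodule.span E (e '' Set.Iio (shift k p)) := by
    have : ∀ v ∈ Submodule.span E (e '' Set.Iio p),
        X k v ∈ Submodule.span E (e '' Set.Iio (shift k p)) := by
      intro v hv
      induction hv using Submodule.span_induction with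
      | mem v hv =>
        obtain ⟨q, hq, rfl⟩ := hv
        rw [← sub_add_cancel (X k (e q)) (e (shift k q))]
        exact add_mem (hlow q hq.le) (Submodule.subset_span ⟨_, hshift k hq, rfl⟩)
      | zero => simp
      | add v w _ _ hv hw => rw [map_add]; exact add_mem hv hw
      | smul c v _ hv =>
        rw [LinearMap.map_smul_of_tower]
        exact Submodule.smul_mem _ c hv
    exact this _ hp
  -- Applying `X k` to the relation for `e p` and removing the error term leaves the relation for `e
  -- (shift k p)`.
  have := sub_mem hXp (hlow p le_rfl)
  rwa [sub_sub_cancel] at this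

end Descent

/-! ### The order on monomials -/

section Monomials

open Finsupp

/-- Indices of the monomials `x^α w_j`, ordered by degree, then lexicographically. -/
abbrev MonomialIndex (n m : ℕ) : Type := DegLex (Fin n →₀ ℕ) ×ₗ Fin m

namespace MonomialIndex

variable {n m : ℕ}

/-- The index of `x^α w_j`. -/
def mk (α : Fin n →₀ ℕ) (j : Fin m) : MonomialIndex n m := toLex (toDegLex α, j)

/-- The exponent. -/
def exponent (p : MonomialIndex n m) : Fin n →₀ ℕ := ofDegLex (ofLex p).1

/-- The degree. -/
noncomputable def deg (p : MonomialIndex n m) : ℕ := p.exponent.degree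

/-- Multiplication by a variable. -/
noncomputable def shift (i : Fin n) (p : MonomialIndex n m) : MonomialIndex n m :=
  mk (p.exponent + single i 1) (ofLex p).2

theorem deg_monotone : Monotone (deg : MonomialIndex n m → ℕ) := by
  intro p q h
  rw [Prod.Lex.le_iff] at h
  rcases h with h | h
  · exact DegLex.monotone_degree h.le
  · exact DegLex.monotone_degree h.1.le

theorem deg_shift (i : Fin n) (p : MonomialIndex n m) : deg (shift i p) = deg p + 1 := by
  change (p.exponent + single i 1).degree = _
  rw [map_add, degree_single]
  rfl

theorem shift_strictMono (i : Fin n) : StrictMono (shift i : MonomialIndex n m → _) := by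
  intro p q h
  rw [Prod.Lex.lt_iff] at h ⊢
  rcases h with h | h
  · left
    exact add_lt_add_left h (toDegLex (single i 1))
  · right
    refine ⟨?_, h.2⟩
    exact congrArg (· + toDegLex (single i 1)) h.1

/-- Dickson's lemma. -/
theorem exists_finite_generators (N : Set (MonomialIndex n m)) :
    ∃ T ⊆ N, T.Finite ∧ ∀ P : MonomialIndex n m → Prop, (∀ t ∈ T, P t) →
      (∀ k p, P p → P (shift k p)) → ∀ p ∈ N, P p := by
  let T : Fin m → Set (Fin n →₀ ℕ) := fun j => {α | Minimal (fun α => mk α j ∈ N) α}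
  refine ⟨⋃ j, (fun α => mk α j) '' T j, ?_, ?_, fun P hT hP p hp => ?_⟩
  · refine Set.iUnion_subset fun j => ?_
    rintro _ ⟨α, hα, rfl⟩
    exact hα.1
  · refine Set.finite_iUnion fun j => Set.Finite.image _ ?_
    -- For each `j` the minimal exponents form an antichain in `ℕⁿ`, which is well quasi-ordered.
    exact WellQuasiOrderedLE.finite_of_isAntichain (setOfPred_minimal_antichain _)
  · obtain ⟨α, hα, hmin⟩ := exists_minimal_le_of_wellFoundedLT
      (fun α => mk α (ofLex p).2 ∈ N) p.exponent hp
    obtain ⟨γ, hγ⟩ := exists_add_of_le hα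
    have h : ∀ s : Multiset (Fin n), P (mk (α + Multiset.toFinsupp s) (ofLex p).2) := by
      intro s
      induction s using Multiset.induction_on with
      | empty =>
        rw [map_zero, add_zero]
        exact hT _ (Set.mem_iUnion.2 ⟨_, α, hmin, rfl⟩)
      | cons i s ih =>
        rw [← Multiset.singleton_add, map_add, Multiset.toFinsupp_singleton, add_comm (single i 1),
          ← add_assoc]
        exact hP i _ ih
    have := h (Finsupp.toMultiset γ)
    rw [Finsupp.toMultiset_toFinsupp, ← hγ] at this
    exact this

end MonomialIndex

end Monomials

namespace EquivData

/-! ### Words in a basis of `𝔤` and their straightening -/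

section Words

variable {F A g k Fbar V : Type*} [Field F] [CommRing A] [HopfAlgebra F A] [LieRing g]
  [LieAlgebra F g] [Field Fbar] [Algebra F Fbar]
  [AddCommGroup V] [Module F V] [Module Fbar V] [IsScalarTower F Fbar V]
  {n m : ℕ}

/-- The operator of a word in elements `x i` of `𝔤`. -/
def word (d : EquivData F A g Fbar V) (x : Fin n → g) (l : List (Fin n)) : Module.End Fbar V :=
  (l.map fun i => d.act (x i)).prod

theorem word_cons (d : EquivData F A g Fbar V) (x : Fin n → g) (i : Fin n) (l : List (Fin n))
    (v : V) : d.word x (i :: l) v = d.act (x i) (d.word x l v) := by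
  simp [word]

/-- The vectors obtained by applying words of length less than `N` to the `w j`. -/
def wordsLT (d : EquivData F A g Fbar V) (x : Fin n → g) (w : Fin m → V) (N : ℕ) : Set V :=
  {v | ∃ l : List (Fin n), l.length < N ∧ ∃ j, d.word x l (w j) = v}

/-- The vectors obtained by applying words to the `w j`. -/
def words (d : EquivData F A g Fbar V) (x : Fin n → g) (w : Fin m → V) : Set V :=
  {v | ∃ (l : List (Fin n)) (j : Fin m), d.word x l (w j) = v}

variable {d : EquivData F A g Fbar V}

theorem word_mem_wordsLT (x : Fin n → g) (w : Fin m → V) {N : ℕ} {l : List (Fin n)}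
    (hl : l.length < N) (j : Fin m) : d.word x l (w j) ∈ Submodule.span F (d.wordsLT x w N) :=
  Submodule.subset_span ⟨l, hl, j, rfl⟩

section

variable [Field k] [Algebra F k] [Algebra k Fbar] [Module k V] [IsScalarTower F k V]
  [IsScalarTower k Fbar V]

omit [Algebra k Fbar] [IsScalarTower k Fbar V] in
theorem act_mem_span (b : Module.Basis (Fin n) F g) {W : Submodule k V} {v : V}
    (h : ∀ i, d.act (b i) v ∈ W) (y : g) : d.act y v ∈ W := by
  rw [← b.sum_repr y, map_sum, LinearMap.sum_apply]
  refine sum_mem fun i _ => ?_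
  rw [map_smul, LinearMap.smul_apply]
  exact (W.restrictScalars F).smul_mem _ (h i)

/-- The space spanned by all words is stable. -/
theorem isStableOver_span_words {P : HCPair F A g} (hd : d.IsGKModule P)
    (b : Module.Basis (Fin n) F g) (w : Fin m → V)
    (hw : ∀ j, d.coact (w j) ∈ tensorRange A (Submodule.span k (d.words b w))) :
    d.IsStableOver (Submodule.span k (d.words b w)) := by
  have ha : ∀ (y : g), ∀ v ∈ d.words b w, d.act y v ∈ Submodule.span k (d.words b w) := by
    rintro y _ ⟨l, j, rfl⟩
    refine act_mem_span b (fun i => ?_) y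
    rw [← word_cons]
    exact Submodule.subset_span ⟨i :: l, j, rfl⟩
  have ha' : ∀ (y : g), ∀ v ∈ Submodule.span k (d.words b w),
      d.act y v ∈ Submodule.span k (d.words b w) := by
    intro y v hv
    induction hv using Submodule.span_induction with
    | mem v hv => exact ha y v hv
    | zero => simp
    | add v w _ _ hv hw => rw [map_add]; exact add_mem hv hw
    | smul c v _ hv =>
      rw [LinearMap.map_smul_of_tower]
      exact Submodule.smul_mem _ c hv
  refine isStableOver_span ?_ ha
  rintro _ ⟨l, j, rfl⟩
  induction l with
  | nil => exact hw j
  | cons i l ih =>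
    -- Equivariance reduces the coaction on a longer word to that on the shorter one. What `Ad (b
    -- i)` is does not matter, as the span is stable under all of `𝔤`.
    rw [word_cons, hd.equivariant]
    generalize P.Ad (b i) = s
    induction s with
    | zero => simp
    | add s s' hs hs' =>
      rw [map_add, LinearMap.add_apply]
      exact add_mem hs hs'
    | tmul y a =>
      refine tensorRange_induction ih ?_ (fun v hv c => ?_) (fun s t hs ht => ?_)
      · simp
      · rw [TensorProduct.map₂_apply_tmul, TensorProduct.map_tmul]
        exact tmul_mem_tensorRange (ha' y v hv) _
      · rw [map_add]
        exact add_mem hs ht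

end

theorem act_mem_span_wordsLT (b : Module.Basis (Fin n) F g) (w : Fin m → V) {N : ℕ} {v : V}
    (hv : v ∈ Submodule.span F (d.wordsLT b w N)) (y : g) :
    d.act y v ∈ Submodule.span F (d.wordsLT b w (N + 1)) := by
  refine act_mem_span b (fun i => ?_) y
  induction hv using Submodule.span_induction with
  | mem v hv =>
    obtain ⟨l, hl, j, rfl⟩ := hv
    rw [← word_cons]
    exact word_mem_wordsLT _ _ (by simpa using hl) j
  | zero => simp
  | add v w _ _ hv hw => rw [map_add]; exact add_mem hv hw
  | smul c v _ hv =>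
    rw [LinearMap.map_smul_of_tower]
    exact Submodule.smul_mem _ c hv

/-- Permuting a word changes its action by shorter words. -/
theorem word_sub_word_mem {P : HCPair F A g} (hd : d.IsGKModule P)
    (b : Module.Basis (Fin n) F g) (w : Fin m → V) (j : Fin m) {l l' : List (Fin n)}
    (h : l.Perm l') :
    d.word b l (w j) - d.word b l' (w j) ∈ Submodule.span F (d.wordsLT b w l.length) := by
  induction h with
  | nil => simp
  | cons i _ ih =>
    rw [word_cons, word_cons, ← map_sub]
    exact act_mem_span_wordsLT b w ih _
  | swap i i' l =>
    -- The difference is the action of a bracket on the word `l`. Expanding the bracket in the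
    -- `F`-basis of `𝔤` gives words one letter shorter, with coefficients in `F`.
    rw [word_cons, word_cons, word_cons, word_cons, ← hd.lie]
    exact act_mem_span_wordsLT b w (word_mem_wordsLT _ _ (by simp) j) _
  | trans h _ ih ih' =>
    rw [← sub_add_sub_cancel]
    rw [← h.length_eq] at ih'
    exact add_mem ih ih'

/-- The ordered monomials `x^α w_j`. -/
noncomputable def monomialVector (d : EquivData F A g Fbar V) (x : Fin n → g) (w : Fin m → V)
    (p : MonomialIndex n m) : V :=
  -- The list is one chosen ordering of the letters; another choice changes the vector only by
  -- shorter words.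
  d.word x (Finsupp.toMultiset p.exponent).toList (w (ofLex p).2)

theorem length_toList_exponent (p : MonomialIndex n m) :
    (Finsupp.toMultiset p.exponent).toList.length = p.deg := by
  rw [Multiset.length_toList, Finsupp.card_toMultiset]
  rfl

theorem span_monomialVector_mono (x : Fin n → g) (w : Fin m → V) {N N' : ℕ} (h : N ≤ N') :
    Submodule.span F (d.monomialVector x w '' {q | q.deg ≤ N}) ≤
      Submodule.span F (d.monomialVector x w '' {q | q.deg ≤ N'}) := by
  refine Submodule.span_mono (Set.image_mono ?_)
  intro q hq
  exact le_trans (show q.deg ≤ N from hq) h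

/-- Words are combinations of ordered monomials. -/
theorem word_mem_span_monomialVector {P : HCPair F A g} (hd : d.IsGKModule P)
    (b : Module.Basis (Fin n) F g) (w : Fin m → V) (j : Fin m) (l : List (Fin n)) :
    d.word b l (w j) ∈ Submodule.span F (d.monomialVector b w '' {q | q.deg ≤ l.length}) := by
  induction hN : l.length using Nat.strong_induction_on generalizing l j with
  | _ N ih =>
    subst hN
    -- The monomial with the same letters as `l`; it differs from the word by shorter words, which
    -- the induction hypothesis covers.
    let p : MonomialIndex n m := MonomialIndex.mk (Multiset.toFinsupp (l : Multiset (Fin n))) j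
    have hp : l.Perm (Finsupp.toMultiset p.exponent).toList := by
      rw [← Multiset.coe_eq_coe, Multiset.coe_toList]
      exact (Multiset.toFinsupp_toMultiset _).symm
    have h₁ : d.word b l (w j) - d.monomialVector b w p ∈ _ := word_sub_word_mem hd b w j hp
    have h₂ : d.monomialVector b w p ∈
        Submodule.span F (d.monomialVector b w '' {q | q.deg ≤ l.length}) :=
      Submodule.subset_span ⟨p, by
        rw [Set.mem_ofPred_eq, ← length_toList_exponent, hp.length_eq], rfl⟩
    rw [← sub_add_cancel (d.word b l (w j)) (d.monomialVector b w p)]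
    refine add_mem (Submodule.span_le.2 ?_ h₁) h₂
    rintro _ ⟨l', hl', j', rfl⟩
    exact span_monomialVector_mono b w (le_of_lt hl') (ih _ hl' j' l' rfl)

/-- Both vectors come from orderings of the same letters, `deg p + 1` in number, so they differ by
words of length at most `deg p`. This is the leading-term condition for propagating relations. -/
theorem act_monomialVector_sub_mem {P : HCPair F A g} (hd : d.IsGKModule P)
    (b : Module.Basis (Fin n) F g) (w : Fin m → V) (i : Fin n) (p : MonomialIndex n m) :
    d.act (b i) (d.monomialVector b w p) - d.monomialVector b w (p.shift i) ∈
      Submodule.span F (d.monomialVector b w '' {q | q.deg ≤ p.deg}) := by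
  have hp : (i :: (Finsupp.toMultiset p.exponent).toList).Perm
      (Finsupp.toMultiset (p.shift i).exponent).toList := by
    rw [← Multiset.coe_eq_coe, Multiset.coe_toList, ← Multiset.cons_coe, Multiset.coe_toList]
    change _ = Finsupp.toMultiset (p.exponent + Finsupp.single i 1)
    rw [map_add, Finsupp.toMultiset_single, one_smul, add_comm, Multiset.singleton_add]
  have h := word_sub_word_mem hd b w (ofLex p).2 hp
  rw [word_cons] at h
  refine Submodule.span_le.2 ?_ h
  rintro _ ⟨l', hl', j', rfl⟩
  rw [List.length_cons, length_toList_exponent] at hl'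
  exact span_monomialVector_mono b w (Nat.lt_succ_iff.1 hl')
    (word_mem_span_monomialVector hd b w j' l')

/-- Stability under `K` and `𝔤` is visible on words, while the ordering that produces a basis is on
monomials; the equality of spans links the two. -/
theorem span_words_eq {P : HCPair F A g} (hd : d.IsGKModule P)
    (b : Module.Basis (Fin n) F g) (w : Fin m → V) :
    Submodule.span F (d.words b w) = Submodule.span F (Set.range (d.monomialVector b w)) := by
  apply le_antisymm
  · refine Submodule.span_le.2 ?_
    rintro _ ⟨l, j, rfl⟩
    exact Submodule.span_mono (Set.image_subset_range _ _) (word_mem_span_monomialVector hd b w j l)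
  · refine Submodule.span_mono ?_
    rintro _ ⟨p, rfl⟩
    exact ⟨_, _, rfl⟩

theorem span_words_eq' [Field k] [Algebra F k] [Module k V] [IsScalarTower F k V]
    {P : HCPair F A g} (hd : d.IsGKModule P) (b : Module.Basis (Fin n) F g) (w : Fin m → V) :
    Submodule.span k (d.words b w) = Submodule.span k (Set.range (d.monomialVector b w)) := by
  rw [← Submodule.span_span_of_tower F k, span_words_eq hd, Submodule.span_span_of_tower]

end Words

/-! ### Schur's lemma for irreducible objects -/

section Schur

variable {F A L L' k V V' : Type*} [Field F] [CommRing A] [HopfAlgebra F A]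
  [AddCommGroup L] [Module F L] [AddCommGroup L'] [Module F L'] [Field k] [Algebra F k]
  [AddCommGroup V] [Module F V] [Module k V] [IsScalarTower F k V]
  [AddCommGroup V'] [Module F V'] [Module k V'] [IsScalarTower F k V']

theorem comp_mem_homK {d : EquivData F A L k V} {d' : EquivData F A L' k V'} {f : V →ₗ[k] V}
    (hf : f ∈ d.homK d) {φ : V' →ₗ[k] V} (hφ : φ ∈ d'.homK d) : f ∘ₗ φ ∈ d'.homK d := fun v => by
  rw [LinearMap.comp_apply, hf, hφ, ← LinearMap.comp_apply, ← LinearMap.rTensor_comp]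
  rfl

/-- Kernels of endomorphisms are stable. -/
theorem isStable_ker {d : EquivData F A L k V} {f : V →ₗ[k] V} (hf : f ∈ d.homK d)
    (hact : ∀ x v, f (d.act x v) = d.act x (f v)) : d.IsStable (LinearMap.ker f) := by
  refine ⟨fun v hv => ?_, fun x v hv => ?_⟩
  · have hex : Function.Exact (((LinearMap.ker f).restrictScalars F).subtype)
        (f.restrictScalars F) := by
      intro v
      exact ⟨fun h => ⟨⟨v, h⟩, rfl⟩, fun ⟨w, hw⟩ => hw ▸ w.2⟩
    have hex' := Module.Flat.rTensor_exact A hex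
    exact (hex' _).1 (by rw [← hf v, LinearMap.mem_ker.1 hv, map_zero])
  · rw [LinearMap.mem_ker] at hv ⊢
    rw [hact, hv, map_zero]

/-- An endomorphism of an irreducible object with an eigenvector is a scalar. -/
theorem IsIrreducible.eq_smul {d : EquivData F A L k V} (hd : d.IsIrreducible) {f : V →ₗ[k] V}
    (hf : f ∈ d.homK d) (hact : ∀ x v, f (d.act x v) = d.act x (f v)) {c : k} {v₀ : V}
    (hv₀ : v₀ ≠ 0) (h : f v₀ = c • v₀) (v : V) : f v = c • v := by
  have hst : d.IsStable (LinearMap.ker (f - c • LinearMap.id)) :=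
    isStable_ker (sub_mem hf ((d.homK d).smul_mem c d.id_mem_homK)) fun x v => by simp [hact]
  rcases hd.2 _ hst with hbot | htop
  · have h₀ : v₀ ∈ LinearMap.ker (f - c • LinearMap.id) := by simp [h]
    rw [hbot, Submodule.mem_bot] at h₀
    exact absurd h₀ hv₀
  · have h₁ : v ∈ LinearMap.ker (f - c • LinearMap.id) := by rw [htop]; trivial
    simpa [sub_eq_zero] using h₁

theorem IsIrreducible.hasScalarEnd_of_finiteDimensional [IsAlgClosed k] [FiniteDimensional k V]
    {d : EquivData F A L k V} (hd : d.IsIrreducible) : d.HasScalarEnd := by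
  intro f hf hact
  have := hd.1
  obtain ⟨c, hc⟩ := Module.End.exists_eigenvalue f
  obtain ⟨v₀, hv₀⟩ := hc.exists_hasEigenvector
  exact ⟨c, hd.eq_smul hf hact hv₀.2 hv₀.apply_eq_smul⟩

/-- In infinite dimension an eigenvector is not automatic. Multiplicity one supplies it: `f ∘ φ` is
a multiple of `φ`, so every nonzero value of `φ` is an eigenvector of `f`. -/
theorem IsIrreducible.hasScalarEnd_of_finrank_homK {d : EquivData F A L k V}
    {d' : EquivData F A L' k V'} (hd : d.IsIrreducible)
    (hmult : Module.finrank k (d'.homK d) = 1) : d.HasScalarEnd := by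
  intro f hf hact
  obtain ⟨⟨φ, hφ⟩, hφ0, hφ1⟩ := finrank_eq_one_iff'.1 hmult
  obtain ⟨v, hv⟩ : ∃ v, φ v ≠ 0 := by
    by_contra! h
    exact hφ0 (Subtype.ext (LinearMap.ext h))
  obtain ⟨c, hc⟩ := hφ1 ⟨f ∘ₗ φ, comp_mem_homK hf hφ⟩
  have e : c • φ = f ∘ₗ φ := congrArg Subtype.val hc
  exact ⟨c, hd.eq_smul hf hact hv (LinearMap.congr_fun e v).symm⟩

end Schur

/-! ### Existence of forms over finite Galois extensions -/

section Forms

variable {F A : Type*} [Field F] [CommRing A] [HopfAlgebra F A]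
variable {Fbar : Type*} [Field Fbar] [Algebra F Fbar] [IsGalois F Fbar]

/-- A finite-dimensional representation has a form over a finite Galois extension. -/
theorem exists_form_of_isKRep {V : Type w} [AddCommGroup V] [Module F V] [Module Fbar V]
    [IsScalarTower F Fbar V] [FiniteDimensional Fbar V] {d : EquivData F A PUnit.{1} Fbar V}
    (hd : d.IsKRep) :
    ∃ (E : IntermediateField F Fbar) (_ : FiniteDimensional F E) (_ : IsGalois F E),
      Nonempty (Form d E fun _ _ _ _ _ d' => d'.IsKRep) := by
  let b := Module.finBasis Fbar V
  have h := fun j => exists_finite_mem_tensorRange (F := F) (LinearMap.id : V →ₗ[Fbar] V) b.span_eq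
    (d.coact (b j))
  choose S hS hSE using h
  have : Finite (⋃ j, S j) := Set.finite_iUnion hS
  let E := FiniteGaloisIntermediateField.adjoin F (⋃ j, S j)
  have := isScalarTower_intermediateField E.toIntermediateField V
  have hE : ∀ j, S j ⊆ E.toIntermediateField := fun j =>
    (Set.subset_iUnion S j).trans (FiniteGaloisIntermediateField.subset_adjoin F _)
  have hst : d.IsStableOver (Submodule.span E.toIntermediateField (Set.range b)) := by
    refine isStableOver_span ?_ fun x v _ => ?_
    · rintro _ ⟨j, rfl⟩
      have := hSE j E.toIntermediateField (hE j) (Submodule.span _ (Set.range b))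
        (fun r hr => Submodule.subset_span hr)
      rwa [show (LinearMap.id : V →ₗ[Fbar] V).restrictScalars F = LinearMap.id from rfl,
        LinearMap.rTensor_id] at this
    · rw [Subsingleton.elim x 0, map_zero]
      exact zero_mem _
  exact ⟨E.toIntermediateField, inferInstance, inferInstance, exists_form_of_isStableOver b hst
    (isCoaction_of_injective (Submodule.injective_subtype _) (restrictData_coact d _ hst) hd)⟩

/-- An irreducible `(𝔤, K)`-module that contains a finite-dimensional representation of `K` has a
form over a finite Galois extension. -/
theorem exists_form_of_isGKModule {g : Type*} [LieRing g] [LieAlgebra F g] [FiniteDimensional F g]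
    {P : HCPair F A g} {V : Type w} [AddCommGroup V] [Module F V] [Module Fbar V]
    [IsScalarTower F Fbar V] {d : EquivData F A g Fbar V} (hd : d.IsGKModule P)
    (hirr : d.IsIrreducible) {L' V' : Type*} [AddCommGroup L'] [Module F L'] [AddCommGroup V']
    [Module F V'] [Module Fbar V'] [IsScalarTower F Fbar V'] [FiniteDimensional Fbar V']
    {d' : EquivData F A L' Fbar V'} {φ : V' →ₗ[Fbar] V} (hφ : φ ∈ d'.homK d) (hφ0 : φ ≠ 0) :
    ∃ (E : IntermediateField F Fbar) (_ : FiniteDimensional F E) (_ : IsGalois F E),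
      Nonempty (Form d E fun _ _ _ _ _ d' => d'.IsGKModule P) := by
  let b := Module.finBasis Fbar V'
  let x := Module.finBasis F g
  let w := fun j => φ (b j)
  have h := fun j => exists_finite_mem_tensorRange (F := F) φ b.span_eq (d'.coact (b j))
  choose S₀ hS₀ hSE₀ using h
  have hstable : ∀ (E : IntermediateField F Fbar) [IsScalarTower F E V], (∀ j, S₀ j ⊆ E) →
      d.IsStableOver (Submodule.span E (d.words x w)) := by
    intro E _ hE
    refine isStableOver_span_words hd x w fun j => ?_
    rw [hφ (b j)]
    refine hSE₀ j E (hE j) _ ?_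
    rintro _ ⟨i, rfl⟩
    exact Submodule.subset_span ⟨[], i, rfl⟩
  -- Taking `E` to be all of `F̄` makes the span of the words a stable subspace; it is nonzero
  -- because it contains the image of `φ`, so irreducibility applies.
  have htop : Submodule.span Fbar (d.words x w) = ⊤ := by
    have := isScalarTower_intermediateField (⊤ : IntermediateField F Fbar) V
    have hst := (hstable ⊤ fun j => Set.subset_univ _).isStable_span
    rw [Submodule.span_span_of_tower] at hst
    refine (hirr.2 _ hst).resolve_left fun hbot => hφ0 (b.ext fun j => ?_)
    have hj : φ (b j) ∈ Submodule.span Fbar (d.words x w) :=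
      Submodule.subset_span ⟨[], j, rfl⟩
    rw [hbot, Submodule.mem_bot] at hj
    rw [hj, LinearMap.zero_apply]
  obtain ⟨S₁, hS₁, hSE₁⟩ := exists_finite_forall_mem_span MonomialIndex.deg
    MonomialIndex.deg_monotone MonomialIndex.shift MonomialIndex.shift_strictMono
    MonomialIndex.deg_shift MonomialIndex.exists_finite_generators (d.monomialVector x w)
    (fun i => d.act (x i)) (act_monomialVector_sub_mem hd x w)
  -- `S₀` serves the coaction on the generators `w j`, and `S₁` the relations among the monomials.
  have : Finite ((⋃ j, S₀ j) ∪ S₁ : Set Fbar) := (Set.finite_iUnion hS₀).union hS₁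
  let E := FiniteGaloisIntermediateField.adjoin F ((⋃ j, S₀ j) ∪ S₁)
  have := isScalarTower_intermediateField E.toIntermediateField V
  have hE : (⋃ j, S₀ j) ∪ S₁ ⊆ E.toIntermediateField :=
    FiniteGaloisIntermediateField.subset_adjoin F _
  -- Over `E` the nonstandard monomials are eliminated, so the `E`-span of an `F̄`-basis coincides
  -- with the span of all words, whose stability is known.
  have hspanE : Submodule.span E.toIntermediateField (d.words x w) =
      Submodule.span E.toIntermediateField
        (d.monomialVector x w '' standardIndices Fbar (d.monomialVector x w)) := by
    rw [span_words_eq' hd]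
    refine le_antisymm (Submodule.span_le.2 ?_) (Submodule.span_mono (Set.image_subset_range _ _))
    rintro _ ⟨p, rfl⟩
    exact mem_span_image_of_wellFounded _ _
      (hSE₁ E.toIntermediateField (Set.subset_union_right.trans hE)) p
  have hspan : ⊤ ≤ Submodule.span Fbar (Set.range fun p :
      standardIndices Fbar (d.monomialVector x w) => d.monomialVector x w p) := by
    rw [← Set.image_eq_range, ← htop,
      ← Submodule.span_span_of_tower E.toIntermediateField Fbar (d.words x w), hspanE,
      Submodule.span_span_of_tower]
  let B := Module.Basis.mk (linearIndepOn_standardIndices (K := Fbar) (d.monomialVector x w)) hspan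
  have hst : d.IsStableOver (Submodule.span E.toIntermediateField (Set.range B)) := by
    rw [show ⇑B = _ from Module.Basis.coe_mk _ hspan, ← Set.image_eq_range, ← hspanE]
    exact hstable _ fun j =>
      (Set.subset_iUnion S₀ j).trans (Set.subset_union_left.trans hE)
  exact ⟨E.toIntermediateField, inferInstance, inferInstance, exists_form_of_isStableOver B hst
    (isGKModule_of_injective (Submodule.injective_subtype _) (restrictData_coact d _ hst)
      (restrictData_act d _ hst) hd)⟩

end Forms

end EquivData

/-! ### The comparison of the two Borel–Tits classes -/

theorem mainTheorem10
    {F : Type*} [Field F] [CharZero F]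
    {Fbar : Type*} [Field Fbar] [Algebra F Fbar] [IsAlgClosure F Fbar]
    {A : Type*} [CommRing A] [HopfAlgebra F A] [Algebra.FiniteType F A]
    {g : Type*} [LieRing g] [LieAlgebra F g] [FiniteDimensional F g]
    (P : HCPair F A g)
    {V : Type*} [AddCommGroup V] [Module F V] [Module Fbar V] [IsScalarTower F Fbar V]
    (dV : EquivData F A g Fbar V) (hV : dV.IsGKModule P) (hVirr : dV.IsIrreducible)
    {τ : Type*} [AddCommGroup τ] [Module F τ] [Module Fbar τ] [IsScalarTower F Fbar τ]
    [FiniteDimensional Fbar τ]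
    (dτ : EquivData F A PUnit.{1} Fbar τ) (hτ : dτ.IsKRep) (hτirr : dτ.IsIrreducible)
    (hτconj : dτ.IsSelfConjugate)
    (hmult : Module.finrank Fbar (dτ.homK dV) = 1) :
    ∃ (βV : ContH2 dV.rationalityGroup Fbarˣ) (βτ : ContH2 dτ.rationalityGroup Fbarˣ),
      (∀ c, dV.IsBorelTitsClassGK P c ↔ c = βV) ∧
      (∀ c, dτ.IsBorelTitsClassK c ↔ c = βτ) ∧
      βV = EquivData.restriction (hτconj.le dV.rationalityGroup) βτ := by
  have : IsAlgClosed Fbar := IsAlgClosure.isAlgClosed F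
  have : Algebra.IsAlgebraic F Fbar := IsAlgClosure.isAlgebraic
  have : Normal F Fbar := IsAlgClosure.normal F Fbar
  -- Separability comes from characteristic zero.
  have : IsGalois F Fbar := ⟨⟩
  have : Nontrivial V := hVirr.1
  have : Nontrivial τ := hτirr.1
  obtain ⟨⟨φ, hφ⟩, hφ0, -⟩ := finrank_eq_one_iff'.1 hmult
  obtain ⟨E, _, _, ⟨X⟩⟩ := EquivData.exists_form_of_isGKModule hV hVirr hφ
    (fun h => hφ0 (Subtype.ext h))
  obtain ⟨E', _, _, ⟨X'⟩⟩ := EquivData.exists_form_of_isKRep hτ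
  obtain ⟨S, b, hS, hb⟩ := EquivData.exists_isTwistSystem_of_form
    (fun _ _ _ _ _ _ d' => d'.IsGKModule P) (hVirr.hasScalarEnd_of_finrank_homK hmult) E X
  obtain ⟨T, b', hT, hb'⟩ := EquivData.exists_isTwistSystem_of_form
    (fun _ _ _ _ _ _ d' => d'.IsKRep) hτirr.hasScalarEnd_of_finiteDimensional E' X'
  -- Self-conjugacy of `τ` makes its system defined on all of `Γ_F`; restricted to `Γ_V`, it can be
  -- compared with that of `V`.
  obtain ⟨b'', hT', hb''⟩ := hT.restrict (hτconj.le dV.rationalityGroup)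
  exact ⟨QuotientGroup.mk b, QuotientGroup.mk b', hb, hb',
    (hS.class_eq_of_finrank_homK hmult hT').trans hb''⟩
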